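/- For integers $n,k\ge 0$ let $T(n,k)$ be one of the following three triangles: the binomial coefficients $\binom nk$, the Stirling numbers of the second kind ${n\brace k}$, the unsigned Stirling numbers of the first kind ${n\brack k}$. For $n\ge1$ they satisfy $T(n,k)=a(n,k)\,T(n-1,k-1)+b(n,k)\,T(n-1,k)$ with $a(n,k)=1$ and $b(n,k)=1$, $k$, $n-1$, respectively (with $T(n,-1)=0$). Set $$p_0(n,k)=\frac{b(n,k)T(n-1,k)}{T(n,k)},\qquad p_1(n,k)=\frac{a(n,k)T(n-1,k-1)}{T(n,k)} ,$$ and let $\mathbb P_{(m,\ell)}$ be the law of the Markov chain $W=(W_n)_{0\le n\le m}$ with $W_0=(m,\ell)$ that moves from $(n,k)$ to $(n-1,k-\varepsilon)$ with probability $p_\varepsilon(n,k)$, $\varepsilon\in\{0,1\}$. Define $X_n$, $0\le n\le m$, by $W_n=(m-n,X_{m-n})$, and put $w_m(t)=m^{-1}X_{\lfloor mt\rfloor}$ for $0\le t\le1$, and $\lambda(m,\ell)=(m-\ell)/\ell$. For every $\lambda>0$ there are a unique $\zeta_2(\lambda)>0$ with $\frac{\zeta_2}{1-e^{-\zeta_2}}=1+\lambda$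 and a unique $\zeta_3(\lambda)\in(0,1)$ with $\frac{\zeta_3}{(\zeta_3-1)\ln(1-\zeta_3)}=1+\lambda$. In the three cases let, respectively, $\varphi(\lambda)=\frac1{1+\lambda}$, $\varphi(\lambda)=e^{-\zeta_2(\lambda)}$, $\varphi(\lambda)=1-\zeta_3(\lambda)$. **Theorem.** In each of the three cases: (1) For every $\lambda>0$ and every $B\ge1$ there is exactly one continuous function $\gamma_\lambda$ on $[0,B]$ with $0<\gamma_\lambda(x)<x$ and $\gamma_\lambda'(x)=\varphi\left(\frac{x-\gamma_\lambda(x)}{\gamma_\lambda(x)}\right)$ for $0<x\le B$ (one-sided derivative at $B$) and $\gamma_\lambda(1)=\frac1{1+\lambda}$. It is given on $[0,B]$, respectively, by $$\gamma_\lambda(x)=\frac{x}{1+\lambda},\qquad \gamma_\lambda(x)=\frac{1-e^{-x\zeta_2(\lambda)}}{\zeta_2(\lambda)},\qquad \gamma_\lambda(x)=\frac{1-\zeta_3(\lambda)}{\zeta_3(\lambda)}\ln\left(\frac{1-\zeta_3(\lambda)+x\,\zeta_3(\lambda)}{1-\zeta_3(\lambda)}\right).$$ (2) Let $\lambda_\infty>0$,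 let $m,\ell\to+\infty$ along a sequence with $\lambda(m,\ell)\to\lambda_\infty$. Then: (a) for every $\eta\in(0,1/2)$, $$\lim\,\mathbb P_{(m,\ell)}\left(\sup_{0\le t\le1}\left|w_m(t)-\gamma_{\lambda(m,\ell)}(t)\right|\ge m^{-\eta}\right)=0;$$ (b) for every $\eta\in(0,1/2)$ such that $m^{\eta}\,(\lambda(m,\ell)-\lambda_\infty)\to0$, $$\lim\,\mathbb P_{(m,\ell)}\left(\sup_{0\le t\le1}\left|w_m(t)-\gamma_{\lambda_\infty}(t)\right|\ge m^{-\eta}\right)=0;$$ (c) for every $\delta>0$, $$\lim\,\mathbb P_{(m,\ell)}\left(\sup_{0\le t\le1}\left|w_m(t)-\gamma_{\lambda_\infty}(t)\right|\ge \delta\right)=0.$$ -/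

import Mathlib

open Filter Topology Set
open scoped ENNReal

noncomputable section

namespace PascalChain

/-- The three triangles considered: Pascal's triangle, Stirling numbers of the second kind and
(unsigned) Stirling numbers of the first kind. -/
inductive Triangle where
  | pascal
  | stirlingSecond
  | stirlingFirst

/-- The entry `T(n,k)` of the triangle; it vanishes for `k > n`. -/
def Triangle.T : Triangle → ℕ → ℕ → ℕ
  | .pascal, n, k => n.choose k
  | .stirlingSecond, n, k => n.stirlingSecond k
  | .stirlingFirst, n, k => n.stirlingFirst k

/-- The coefficient `a(n,k)` of Pascal's formula
`T(n,k) = a(n,k) T(n-1,k-1) + b(n,k) T(n-1,k)`, equal to `1` for these three triangles. -/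
def Triangle.a (_c : Triangle) (_n _k : ℕ) : ℕ := 1

/-- The coefficient `b(n,k)` of Pascal's formula, for `n ≥ 1`. -/
def Triangle.b : Triangle → ℕ → ℕ → ℕ
  | .pascal, _, _ => 1
  | .stirlingSecond, _, k => k
  | .stirlingFirst, n, _ => n - 1

/-- `T(n-1,k-1)` for `n ≥ 1`, with the convention that it is `0` when `k = 0`. -/
def Triangle.prevDiag (c : Triangle) (n : ℕ) : ℕ → ℕ
  | 0 => 0
  | k + 1 => c.T (n - 1) k

theorem Triangle.pascal_formula (c : Triangle) {n : ℕ} (hn : n ≠ 0) (k : ℕ) :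
    c.T n k = c.a n k * c.prevDiag n k + c.b n k * c.T (n - 1) k := by
  obtain ⟨n, rfl⟩ := Nat.exists_eq_succ_of_ne_zero hn
  cases c <;> cases k <;>
    simp [Triangle.T, Triangle.a, Triangle.b, Triangle.prevDiag, Nat.choose_succ_succ,
      Nat.stirlingSecond,
      Nat.stirlingFirst, add_comm]
  cases n <;> simp [Nat.stirlingFirst]

/-- The numerators of the transition probabilities: `b(n,k) T(n-1,k)` for `ε = 0` and
`a(n,k) T(n-1,k-1)` for `ε = 1`. -/
def Triangle.weight (c : Triangle) (n k : ℕ) (ε : Fin 2) : ℕ :=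
  if ε = 0 then c.b n k * c.T (n - 1) k else c.a n k * c.prevDiag n k

/-- The transition probability `p_ε(n,k)` from `(n,k)` to `(n-1,k-ε)`, for `n ≥ 1` and
`T(n,k) ≠ 0`. -/
def Triangle.transProb (c : Triangle) (n k : ℕ) (ε : Fin 2) : ℝ≥0∞ :=
  (c.weight n k ε : ℝ≥0∞) / (c.T n k : ℝ≥0∞)

theorem Triangle.sum_transProb (c : Triangle) {n k : ℕ} (hn : n ≠ 0) (hT : c.T n k ≠ 0) :
    ∑ ε, c.transProb n k ε = 1 := by
  have h : (c.weight n k 0 : ℝ≥0∞) + (c.weight n k 1 : ℝ≥0∞) = (c.T n k : ℝ≥0∞) := by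
    have := c.pascal_formula hn k
    rw [this]
    simp [Triangle.weight, add_comm]
  rw [Fin.sum_univ_two, Triangle.transProb, Triangle.transProb, ← ENNReal.add_div, h]
  exact ENNReal.div_self (by exact_mod_cast hT) (ENNReal.natCast_ne_top _)

open Classical in
/-- One step of the time-reversed chain: from `(n,k)` to `(n-1,k-ε)` with probability
`p_ε(n,k)`. The remaining states, `(0,0)` and those with `T(n,k) = 0`, are made absorbing; a chain
started at `(m,ℓ)` with `T(m,ℓ) ≠ 0` meets none of them during its first `m` steps. -/
def Triangle.step (c : Triangle) (s : ℕ × ℕ) : PMF (ℕ × ℕ) :=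
  if h : s.1 ≠ 0 ∧ c.T s.1 s.2 ≠ 0 then
    (PMF.ofFintype (c.transProb s.1 s.2) (c.sum_transProb h.1 h.2)).map
      (fun ε => (s.1 - 1, s.2 - (ε : ℕ)))
  else PMF.pure s

/-- The law of the first `N` steps `(W_0, …, W_N)` of the Markov chain started at `s`. -/
def Triangle.chain (c : Triangle) (s : ℕ × ℕ) : (N : ℕ) → PMF (Fin (N + 1) → ℕ × ℕ)
  | 0 => PMF.pure (fun _ => s)
  | N + 1 => (Triangle.chain c s N).bind fun w =>
      (c.step (w (Fin.last N))).map fun s' => (Fin.snoc w s' : Fin (N + 2) → ℕ × ℕ)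

/-- `ℙ_{(m,ℓ)}`: the law of `W = (W_0, …, W_m)`, the Markov chain started at `(m,ℓ)`. -/
def Triangle.pathLaw (c : Triangle) (m l : ℕ) : MeasureTheory.Measure (Fin (m + 1) → ℕ × ℕ) :=
  (c.chain (m, l) m).toMeasure

/-- `X_j` for `0 ≤ j ≤ m`, read off from `W_n = (m-n, X_{m-n})`. -/
def levelX {m : ℕ} (W : Fin (m + 1) → ℕ × ℕ) (j : ℕ) : ℕ :=
  (W ⟨m - j, Nat.lt_succ_of_le (Nat.sub_le m j)⟩).2

/-- The rescaled path `w_m(t) = X_{⌊mt⌋} / m`, for `0 ≤ t ≤ 1`. -/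
def rescaled {m : ℕ} (W : Fin (m + 1) → ℕ × ℕ) (t : ℝ) : ℝ :=
  (levelX W ⌊(m : ℝ) * t⌋₊ : ℝ) / (m : ℝ)

/-- The uniform distance on `[0,1]` between two functions, with values in `[0,∞]`. -/
def supDist (f g : ℝ → ℝ) : ℝ≥0∞ :=
  ⨆ t ∈ Icc (0 : ℝ) 1, ENNReal.ofReal |f t - g t|

/-- `λ(m,ℓ) = (m-ℓ)/ℓ`. -/
def lam (m l : ℕ) : ℝ := ((m : ℝ) - (l : ℝ)) / (l : ℝ)

/-- The defining property of `ζ₂(λ)`. -/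
def IsZeta2 (x z : ℝ) : Prop := 0 < z ∧ z / (1 - Real.exp (-z)) = 1 + x

/-- The defining property of `ζ₃(λ)`. -/
def IsZeta3 (x z : ℝ) : Prop := 0 < z ∧ z < 1 ∧ z / ((z - 1) * Real.log (1 - z)) = 1 + x

/-- `ζ₂(λ)`, the positive solution of `ζ/(1-e^{-ζ}) = 1+λ` (for `λ > 0`). -/
def zeta2 (x : ℝ) : ℝ := Classical.epsilon (IsZeta2 x)

/-- `ζ₃(λ)`, the solution in `(0,1)` of `ζ/((ζ-1) log(1-ζ)) = 1+λ` (for `λ > 0`). -/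
def zeta3 (x : ℝ) : ℝ := Classical.epsilon (IsZeta3 x)

/-- The limit slope `φ(λ)`, `λ > 0`. -/
def Triangle.phi : Triangle → ℝ → ℝ
  | .pascal, x => 1 / (1 + x)
  | .stirlingSecond, x => Real.exp (-zeta2 x)
  | .stirlingFirst, x => 1 - zeta3 x

/-- The explicit curve `γ_λ`. -/
def Triangle.gamma : Triangle → ℝ → ℝ → ℝ
  | .pascal, x, t => t / (1 + x)
  | .stirlingSecond, x, t => (1 - Real.exp (-(t * zeta2 x))) / zeta2 x
  | .stirlingFirst, x, t =>
      (1 - zeta3 x) / zeta3 x * Real.log ((1 - zeta3 x + t * zeta3 x) / (1 - zeta3 x))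

/-- `y` is, on `[0,B]`, the field line of `(1, φ(-1 + x/y))` through `(1, 1/(1+r))`: it is
continuous on `[0,B]`, stays in the domain `0 < y < x` of the vector field for `0 < x ≤ B`, and
solves `y' = φ((x-y)/y)` there (with a one-sided derivative at `B`). -/
def Triangle.IsFieldLine (c : Triangle) (r B : ℝ) (y : ℝ → ℝ) : Prop :=
  ContinuousOn y (Icc 0 B) ∧ y 1 = 1 / (1 + r) ∧
    ∀ x ∈ Ioc 0 B, 0 < y x ∧ y x < x ∧
      HasDerivWithinAt y (c.phi ((x - y x) / y x)) (Icc 0 B) x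

end PascalChain

end

/-! The backward probabilities are those of any forward chain whose law at time `n` has the form
`T(n,k) h(n,k)`: the factor `h` disappears on conditioning on the end point. Hence a marginal of the
reversed chain started at `(m,ℓ)` is at most the corresponding forward marginal divided by the
forward probability of `ℓ` at time `m` (`Forward.law_le`).

Each triangle has a one-parameter family of such chains: binomial counts, sums of independent
Bernoulli variables with parameters `θ/(θ+i)`, and occupied boxes among `N`. Log-concavity of
`T(m,·)` allows the parameter to be chosen so that `ℓ` is a mode at time `m`, hence has probability
at least `1/(m+1)`. The centred forward chain contracts in mean up to a Bernoulli noise, so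
Chernoff's bound (`Forward.tail_le`) gives tails `2 exp(-m s²)` at distance `2ms`. Conditioning and
the union over times each cost only a factor `m+1`.

This concentration is around the forward mean, not yet around the field line. In the Stirling cases
the mean is within `1` of `m · curve I v (j/m)` for some `v`; curves with different `v` separate
most at time `1`, and there the error is controlled because the likely value `ℓ` must itself be
close to the mean. In the Pascal case the mean is exactly linear. Taking `s = m^(-e')` with `η < e'
< 1/2` gives the rate.

Uniqueness of field lines comes from homogeneity: the parameter `w` with `I(w)/w = y/x` satisfies
`(w/x)' = 0`, which forces `y` to be one of the curves. -/

noncomputable section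

namespace PascalChain

/-! ### Recursion and log-concavity of the triangles -/

namespace Triangle

variable (c : Triangle)

theorem T_zero_zero : c.T 0 0 = 1 := by cases c <;> simp [T]

theorem T_succ_zero (n : ℕ) : c.T (n + 1) 0 = c.b (n + 1) 0 * c.T n 0 := by
  simpa [a, prevDiag] using c.pascal_formula (Nat.succ_ne_zero n) 0

theorem T_succ_succ (n k : ℕ) :
    c.T (n + 1) (k + 1) = c.T n k + c.b (n + 1) (k + 1) * c.T n (k + 1) := by
  simpa [a, prevDiag] using c.pascal_formula (Nat.succ_ne_zero n) (k + 1)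

theorem T_eq_zero {n k : ℕ} (h : n < k) : c.T n k = 0 := by
  induction n generalizing k with
  | zero =>
    obtain ⟨k, rfl⟩ := Nat.exists_eq_succ_of_ne_zero h.ne'
    cases c <;> simp [T]
  | succ n ih =>
    obtain ⟨k, rfl⟩ := Nat.exists_eq_succ_of_ne_zero (Nat.ne_zero_of_lt h)
    rw [Nat.succ_eq_add_one, T_succ_succ, ih (by lia), ih (by lia)]; simp

theorem T_pos {n k : ℕ} (hk : 1 ≤ k) (hkn : k ≤ n) : 0 < c.T n k := by
  induction n generalizing k with
  | zero => lia
  | succ n ih =>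
    obtain ⟨k, rfl⟩ := Nat.exists_eq_succ_of_ne_zero (Nat.ne_zero_of_lt hk)
    rw [Nat.succ_eq_add_one, T_succ_succ]
    rcases Nat.eq_zero_or_pos k with rfl | h0
    · rcases Nat.eq_zero_or_pos n with rfl | hn
      · simp [T_zero_zero]
      · have h1 := ih (k := 1) le_rfl hn
        have h2 : 0 < c.b (n + 1) 1 := by cases c <;> simp [b, hn]
        positivity
    · have := ih (k := k) h0 (by lia)
      positivity

/-- This affine dependence on `k` is what makes Pascal's recursion preserve log-concavity. -/
theorem b_affine (n k : ℕ) : c.b n k + c.b n (k + 2) = 2 * c.b n (k + 1) := by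
  cases c <;> simp [b] <;> lia

/-- The adjoint form of Pascal's recursion: it moves the step from the triangle to the test
function. -/
theorem sum_T_succ (n : ℕ) (g : ℕ → ℝ) :
    ∑ k ∈ Finset.range (n + 2), (c.T (n + 1) k : ℝ) * g k =
      ∑ k ∈ Finset.range (n + 1), (c.T n k : ℝ) * (g (k + 1) + c.b (n + 1) k * g k) := by
  have h : ∑ k ∈ Finset.range (n + 2), (c.T n k : ℝ) * (c.b (n + 1) k * g k) =
      ∑ k ∈ Finset.range (n + 1), (c.T n k : ℝ) * (c.b (n + 1) k * g k) := by
    rw [Finset.sum_range_succ, c.T_eq_zero (Nat.lt_succ_self n)]; simp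
  simp only [mul_add, Finset.sum_add_distrib]
  rw [← h, Finset.sum_range_succ', Finset.sum_range_succ' _ (n + 1), T_succ_zero, ← add_assoc,
    ← Finset.sum_add_distrib]
  congr 1
  · refine Finset.sum_congr rfl fun k _ => ?_
    rw [T_succ_succ]; push_cast; ring
  · push_cast; ring

end Triangle

/-- Multiplying by a linear factor with coefficients in arithmetic progression keeps
log-concavity. -/
theorem logConcave_step {a₀ a₁ a₂ a₃ b₁ b₂ b₃ : ℝ} (hb₁ : 0 ≤ b₁) (hb₃ : 0 ≤ b₃)
    (hb : b₁ + b₃ = 2 * b₂) (h₀₂ : a₀ * a₂ ≤ a₁ ^ 2) (h₁₃ : a₁ * a₃ ≤ a₂ ^ 2)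
    (h₀₃ : a₀ * a₃ ≤ a₁ * a₂) :
    (a₀ + b₁ * a₁) * (a₂ + b₃ * a₃) ≤ (a₁ + b₂ * a₂) ^ 2 := by
  have hb₂ : b₂ = (b₁ + b₃) / 2 := by linarith
  subst hb₂
  -- Besides `a₁² - a₀a₂`, the difference consists of `b₃(a₁a₂ - a₀a₃)` and `b₂²a₂² - b₁b₃a₁a₃`; the
  -- latter is nonnegative because `b₁b₃ ≤ b₂²`.
  have h1 := mul_le_mul_of_nonneg_left h₁₃ (mul_nonneg hb₁ hb₃)
  have h2 := mul_le_mul_of_nonneg_left h₀₃ hb₃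
  nlinarith [mul_nonneg (sq_nonneg (b₁ - b₃)) (sq_nonneg a₂)]

/-- Two consecutive log-concavity inequalities are multiplied and the middle entries cancelled;
these are positive unless the last entry vanishes. -/
theorem Triangle.T_logConcave_far (c : Triangle) {n k : ℕ}
    (h : ∀ k, (c.T n k : ℝ) * c.T n (k + 2) ≤ (c.T n (k + 1) : ℝ) ^ 2) :
    (c.T n k : ℝ) * c.T n (k + 3) ≤ (c.T n (k + 1) : ℝ) * c.T n (k + 2) := by
  rcases lt_or_ge n (k + 2) with hk | hk
  · rw [c.T_eq_zero (show n < k + 3 by lia)]; simp only [Nat.cast_zero, mul_zero]; positivity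
  · have h1 : (0 : ℝ) < c.T n (k + 1) := by exact_mod_cast c.T_pos (by lia) (by lia)
    have h2 : (0 : ℝ) < c.T n (k + 2) := by exact_mod_cast c.T_pos (by lia) (by lia)
    refine le_of_mul_le_mul_right ?_ (mul_pos h1 h2)
    calc _ = ((c.T n k : ℝ) * c.T n (k + 2)) * (c.T n (k + 1) * c.T n (k + 1 + 2)) := by ring
      _ ≤ (c.T n (k + 1) : ℝ) ^ 2 * (c.T n (k + 1 + 1) : ℝ) ^ 2 :=
        mul_le_mul (h k) (h (k + 1)) (by positivity) (by positivity)
      _ = _ := by ring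

theorem Triangle.T_logConcave (c : Triangle) (n k : ℕ) :
    (c.T n k : ℝ) * c.T n (k + 2) ≤ (c.T n (k + 1) : ℝ) ^ 2 := by
  induction n generalizing k with
  | zero => rw [c.T_eq_zero (show 0 < k + 2 by lia)]; simp only [Nat.cast_zero, mul_zero]; positivity
  | succ n ih =>
    have hb : (c.b (n + 1) k : ℝ) + c.b (n + 1) (k + 2) = 2 * c.b (n + 1) (k + 1) := by
      exact_mod_cast c.b_affine (n + 1) k
    rw [c.T_succ_succ n (k + 1), c.T_succ_succ n k]
    cases k with
    | zero =>
      rw [c.T_succ_zero]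
      push_cast
      -- The missing entry to the left of column `0` is taken to be `0`.
      have := logConcave_step (a₀ := 0) (a₁ := c.T n 0) (a₂ := c.T n 1) (a₃ := c.T n 2)
        (Nat.cast_nonneg _) (Nat.cast_nonneg _) hb (by simp) (ih 0)
        (by simp; positivity)
      simpa using this
    | succ k =>
      rw [c.T_succ_succ n k]
      push_cast
      exact logConcave_step (Nat.cast_nonneg _) (Nat.cast_nonneg _) hb (ih k) (ih (k + 1))
        (c.T_logConcave_far ih)

/-- A log-concave sequence that has a local maximum at `l` has its maximum there. -/
theorem le_of_logConcave {a : ℕ → ℝ} {l : ℕ} (h0 : ∀ k, 0 ≤ a k)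
    (hlc : ∀ k, a k * a (k + 2) ≤ a (k + 1) ^ 2)
    (hpos : ∀ k, 1 ≤ k → k ≤ l → 0 < a k) (hzero : ∀ k, l ≤ k → a k = 0 → a (k + 1) = 0)
    (hl : a (l - 1) ≤ a l) (hr : a (l + 1) ≤ a l) (k : ℕ) : a k ≤ a l := by
  have up : ∀ k, l ≤ k → a (k + 1) ≤ a k := by
    intro k hk
    induction k, hk using Nat.le_induction with
    | base => exact hr
    | succ k hk ih =>
      rcases (h0 k).eq_or_lt with hz | hp
      · rw [hzero (k + 1) (by lia) (hzero k hk hz.symm)]; exact h0 _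
      · refine le_of_mul_le_mul_left ?_ hp
        calc a k * a (k + 2) ≤ a (k + 1) ^ 2 := hlc k
          _ ≤ a k * a (k + 1) := by rw [sq]; exact mul_le_mul_of_nonneg_right ih (h0 _)
  have down : ∀ j, j + 1 ≤ l → a (l - (j + 1)) ≤ a (l - j) := by
    intro j hj
    induction j with
    | zero => simpa using hl
    | succ j ih =>
      have ih := ih (by lia)
      obtain ⟨i, rfl⟩ : ∃ i, l = i + j + 2 := ⟨l - j - 2, by lia⟩
      rw [show i + j + 2 - (j + 1) = i + 1 by lia, show i + j + 2 - j = i + 2 by lia] at ih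
      rw [show i + j + 2 - (j + 1 + 1) = i by lia, show i + j + 2 - (j + 1) = i + 1 by lia]
      refine le_of_mul_le_mul_right ?_ (hpos (i + 2) (by lia) (by lia))
      calc a i * a (i + 2) ≤ a (i + 1) ^ 2 := hlc i
        _ ≤ a (i + 1) * a (i + 2) := by rw [sq]; exact mul_le_mul_of_nonneg_left ih (h0 _)
  rcases le_total l k with hk | hk
  · induction k, hk using Nat.le_induction with
    | base => exact le_rfl
    | succ k hk ih => exact (up k hk).trans ih
  · obtain ⟨j, rfl⟩ : ∃ j, k = l - j := ⟨l - k, by lia⟩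
    clear hk
    induction j with
    | zero => simp
    | succ j ih =>
      by_cases hj : j + 1 ≤ l
      · exact (down j hj).trans ih
      · rw [show l - (j + 1) = l - j by lia]; exact ih

/-! ### Forward chains and their concentration -/

/-- A forward Markov chain on `ℕ`, with transition probabilities `q n k` from `k` at time `n` to
`k + 1` at time `n + 1`, for which `T(n,k) h(n,k)` is the law at time `n`, and whose conditional
mean is a contraction. -/
structure Forward (c : Triangle) where
  h : ℕ → ℕ → ℝ
  q : ℕ → ℕ → ℝ
  μ : ℕ → ℝ
  β : ℝ
  h_nonneg : ∀ n k, 0 ≤ h n k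
  h_zero : h 0 0 = 1
  μ_zero : μ 0 = 0
  up : ∀ n k, h (n + 1) (k + 1) = q n k * h n k
  stay : ∀ n k, (c.b (n + 1) k : ℝ) * h (n + 1) k = (1 - q n k) * h n k
  q_nonneg : ∀ n k, h n k ≠ 0 → 0 ≤ q n k
  q_le_one : ∀ n k, h n k ≠ 0 → q n k ≤ 1
  β_nonneg : 0 ≤ β
  β_le_one : β ≤ 1
  mean : ∀ n k : ℕ, (k : ℝ) + q n k - μ (n + 1) = β * (k - μ n)

namespace Forward

variable {c : Triangle} (F : Forward c)

theorem harmonic (n k : ℕ) :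
    F.h (n + 1) (k + 1) + c.b (n + 1) k * F.h (n + 1) k = F.h n k := by
  rw [F.up, F.stay]; ring

theorem sum_eq_one (n : ℕ) : ∑ k ∈ Finset.range (n + 1), (c.T n k : ℝ) * F.h n k = 1 := by
  induction n with
  | zero => simp [c.T_zero_zero, F.h_zero]
  | succ n ih =>
    rw [c.sum_T_succ n (F.h (n + 1)), ← ih]
    simp only [F.harmonic]

/-- A bound for the moment generating function of a centred Bernoulli variable. -/
theorem bernoulli_mgf_le {q s : ℝ} (h0 : 0 ≤ q) (h1 : q ≤ 1) (hs : |s| ≤ 1) :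
    q * Real.exp (s * (1 - q)) + (1 - q) * Real.exp (-(s * q)) ≤ Real.exp (s ^ 2) := by
  -- The linear terms cancel after averaging, and the quadratic ones leave the variance factor
  -- `q(1-q) ≤ 1`.
  have key : ∀ x : ℝ, |x| ≤ 1 → Real.exp x ≤ 1 + x + x ^ 2 := fun x hx => by
    have := (abs_le.1 (Real.abs_exp_sub_one_sub_id_le hx)).2
    linarith
  have e1 := key (s * (1 - q)) (by
    rw [abs_mul, abs_of_nonneg (by linarith : 0 ≤ 1 - q)]
    exact mul_le_one₀ hs (by linarith) (by linarith))
  have e2 := key (-(s * q)) (by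
    rw [abs_neg, abs_mul, abs_of_nonneg h0]
    exact mul_le_one₀ hs h0 h1)
  have e3 := Real.add_one_le_exp (s ^ 2)
  have e4 := mul_le_mul_of_nonneg_left e1 h0
  have e5 := mul_le_mul_of_nonneg_left e2 (by linarith : 0 ≤ 1 - q)
  have e6 : q * (1 - q) * s ^ 2 ≤ 1 * s ^ 2 :=
    mul_le_mul_of_nonneg_right (by nlinarith) (sq_nonneg s)
  nlinarith

/-- Given `k` at time `n`, the next deviation is `β(k - μ n)` plus a centred Bernoulli variable. The
latter costs `exp(s²)`, and the induction continues with `sβ` in place of `s`. -/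
theorem mgf_le (n : ℕ) {s : ℝ} (hs : |s| ≤ 1) :
    ∑ k ∈ Finset.range (n + 1), (c.T n k : ℝ) * F.h n k * Real.exp (s * (k - F.μ n)) ≤
      Real.exp (n * s ^ 2) := by
  induction n generalizing s with
  | zero => simp [c.T_zero_zero, F.h_zero, F.μ_zero]
  | succ n ih =>
    have hβ : |s * F.β| ≤ |s| := by
      rw [abs_mul, abs_of_nonneg F.β_nonneg]
      exact mul_le_of_le_one_right (abs_nonneg s) F.β_le_one
    have hsq : (s * F.β) ^ 2 ≤ s ^ 2 := sq_le_sq.2 hβ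
    simp only [mul_assoc]
    rw [c.sum_T_succ n fun k => F.h (n + 1) k * Real.exp (s * (k - F.μ (n + 1)))]
    calc _ ≤ ∑ k ∈ Finset.range (n + 1),
          (c.T n k : ℝ) * F.h n k * Real.exp (s * F.β * (k - F.μ n)) * Real.exp (s ^ 2) := by
          refine Finset.sum_le_sum fun k _ => ?_
          rw [mul_assoc, mul_assoc]
          refine mul_le_mul_of_nonneg_left ?_ (Nat.cast_nonneg _)
          rw [← mul_assoc ((c.b (n + 1) k : ℝ)), F.up, F.stay]
          by_cases hz : F.h n k = 0
          · simp [hz]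
          have hm := F.mean n k
          have e1 : Real.exp (s * (((k + 1 : ℕ) : ℝ) - F.μ (n + 1))) =
              Real.exp (s * F.β * (k - F.μ n)) * Real.exp (s * (1 - F.q n k)) := by
            rw [← Real.exp_add, mul_assoc s, ← hm]; congr 1; push_cast; ring
          have e2 : Real.exp (s * ((k : ℝ) - F.μ (n + 1))) =
              Real.exp (s * F.β * (k - F.μ n)) * Real.exp (-(s * F.q n k)) := by
            rw [← Real.exp_add, mul_assoc s, ← hm]; congr 1; ring
          rw [e1, e2]
          calc _ = F.h n k * (Real.exp (s * F.β * (k - F.μ n)) *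
                (F.q n k * Real.exp (s * (1 - F.q n k)) +
                  (1 - F.q n k) * Real.exp (-(s * F.q n k)))) := by ring
            _ ≤ _ := mul_le_mul_of_nonneg_left (mul_le_mul_of_nonneg_left
                (bernoulli_mgf_le (F.q_nonneg n k hz) (F.q_le_one n k hz) hs)
                (Real.exp_pos _).le) (F.h_nonneg n k)
      _ = (∑ k ∈ Finset.range (n + 1),
          (c.T n k : ℝ) * F.h n k * Real.exp (s * F.β * (k - F.μ n))) * Real.exp (s ^ 2) := by
          rw [Finset.sum_mul]
      _ ≤ Real.exp (n * (s * F.β) ^ 2) * Real.exp (s ^ 2) :=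
          mul_le_mul_of_nonneg_right (ih (hβ.trans hs)) (Real.exp_pos _).le
      _ ≤ _ := by
          rw [← Real.exp_add]
          refine Real.exp_le_exp.2 ?_
          push_cast
          nlinarith [mul_le_mul_of_nonneg_left hsq (Nat.cast_nonneg (α := ℝ) n)]

open Classical in
-- Chernoff's bound with exponents `±s`: the threshold `2ms` gains `exp(-2ms²)`, of which the moment
-- bound takes back at most `exp(ms²)`.
theorem tail_le {n m : ℕ} (hn : n ≤ m) {s : ℝ} (hs0 : 0 ≤ s) (hs : s ≤ 1) :
    ∑ k ∈ Finset.range (n + 1),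
        (if 2 * m * s ≤ |(k : ℝ) - F.μ n| then (c.T n k : ℝ) * F.h n k else 0) ≤
      2 * Real.exp (-(m * s ^ 2)) := by
  have h1 := F.mgf_le n (s := s) (by rwa [abs_of_nonneg hs0])
  have h2 := F.mgf_le n (s := -s) (by rwa [abs_neg, abs_of_nonneg hs0])
  have hnm : Real.exp (n * s ^ 2) ≤ Real.exp (m * s ^ 2) :=
    Real.exp_le_exp.2 (mul_le_mul_of_nonneg_right (by exact_mod_cast hn) (sq_nonneg s))
  rw [neg_sq] at h2
  calc _ ≤ ∑ k ∈ Finset.range (n + 1), Real.exp (-(2 * m * s ^ 2)) *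
        ((c.T n k : ℝ) * F.h n k * Real.exp (s * (k - F.μ n)) +
          (c.T n k : ℝ) * F.h n k * Real.exp (-s * (k - F.μ n))) := by
        refine Finset.sum_le_sum fun k _ => ?_
        have hQ : 0 ≤ (c.T n k : ℝ) * F.h n k := mul_nonneg (Nat.cast_nonneg _) (F.h_nonneg n k)
        split_ifs with hk
        · rw [← mul_add, mul_left_comm]
          refine le_mul_of_one_le_right hQ ?_
          rw [mul_add, ← Real.exp_add, ← Real.exp_add]
          rcases le_abs.1 hk with hk | hk
          · have : 1 ≤ Real.exp (-(2 * m * s ^ 2) + s * (k - F.μ n)) :=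
              Real.one_le_exp (by nlinarith)
            linarith [Real.exp_pos (-(2 * m * s ^ 2) + -s * (k - F.μ n))]
          · have : 1 ≤ Real.exp (-(2 * m * s ^ 2) + -s * (k - F.μ n)) :=
              Real.one_le_exp (by nlinarith)
            linarith [Real.exp_pos (-(2 * m * s ^ 2) + s * (k - F.μ n))]
        · have := Real.exp_pos (s * (k - F.μ n))
          have := Real.exp_pos (-s * (k - F.μ n))
          positivity
    _ ≤ Real.exp (-(2 * m * s ^ 2)) * (2 * Real.exp (m * s ^ 2)) := by
        rw [← Finset.mul_sum, Finset.sum_add_distrib]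
        exact mul_le_mul_of_nonneg_left (by linarith) (Real.exp_pos _).le
    _ = _ := by
        rw [mul_left_comm, ← Real.exp_add]; congr 2; ring

/-- If `l` is a mode at time `m`, it has probability at least `1 / (m + 1)`. -/
theorem mode_bound {m l : ℕ} (h : ∀ k, (c.T m k : ℝ) * F.h m k ≤ c.T m l * F.h m l) :
    1 ≤ ((m : ℝ) + 1) * (c.T m l * F.h m l) := by
  refine (F.sum_eq_one m).symm.le.trans ?_
  refine (Finset.sum_le_sum fun k _ => h k).trans ?_
  rw [Finset.sum_const, Finset.card_range, nsmul_eq_mul]; push_cast; rfl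

/-- A value of probability at least `1/(m+1)` cannot lie in a tail of smaller mass. -/
theorem abs_sub_mean_le {m l : ℕ} (hl : l ≤ m)
    (h : 1 ≤ ((m : ℝ) + 1) * (c.T m l * F.h m l)) {s : ℝ} (hs0 : 0 ≤ s) (hs : s ≤ 1)
    (hm : 2 * ((m : ℝ) + 1) * Real.exp (-(m * s ^ 2)) < 1) : |(l : ℝ) - F.μ m| < 2 * m * s := by
  classical
  by_contra! hc
  have h1 := F.tail_le le_rfl hs0 hs (n := m) (m := m)
  have h2 := Finset.single_le_sum (f := fun k : ℕ =>
    if 2 * m * s ≤ |(k : ℝ) - F.μ m| then (c.T m k : ℝ) * F.h m k else 0)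
    (fun k _ => by
      split_ifs
      · exact mul_nonneg (Nat.cast_nonneg _) (F.h_nonneg m k)
      · exact le_rfl) (Finset.mem_range.2 (Nat.lt_succ_of_le hl))
  simp only [if_pos hc] at h2
  have h3 := mul_le_mul_of_nonneg_left (h2.trans h1) (by positivity : (0 : ℝ) ≤ m + 1)
  linarith

end Forward

/-! ### Comparison of the reversed chain with a forward chain -/

/-- The law of `W_n` for the chain started at `s`. -/
def Triangle.law (c : Triangle) (s : ℕ × ℕ) : ℕ → PMF (ℕ × ℕ)
  | 0 => PMF.pure s
  | n + 1 => (c.law s n).bind c.step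

theorem Triangle.chain_map (c : Triangle) (s : ℕ × ℕ) (N : ℕ) (i : Fin (N + 1)) :
    (c.chain s N).map (fun w => w i) = c.law s i := by
  induction N with
  | zero =>
    obtain rfl : i = 0 := Fin.fin_one_eq_zero i
    simp [Triangle.chain, Triangle.law, PMF.pure_map]
  | succ N ih =>
    rw [Triangle.chain, PMF.map_bind]
    simp only [PMF.map_comp]
    refine Fin.lastCases ?_ (fun i => ?_) i
    · simp only [Function.comp_def, Fin.snoc_last]
      have := ih (Fin.last N)
      rw [Fin.val_last, Triangle.law, ← Fin.val_last N, ← this, PMF.bind_map]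
      simp only [Function.comp_def]
      congr 1
      funext w
      exact PMF.map_id _
    · simp only [Function.comp_def, Fin.snoc_castSucc]
      rw [Fin.val_castSucc, ← ih i]
      simp only [PMF.map, Function.comp_def, PMF.bind_const]

theorem Triangle.step_eq (c : Triangle) {s : ℕ × ℕ} (h : s.1 ≠ 0 ∧ c.T s.1 s.2 ≠ 0) :
    c.step s = (PMF.ofFintype (c.transProb s.1 s.2) (c.sum_transProb h.1 h.2)).map
      (fun ε : Fin 2 => (s.1 - 1, s.2 - (ε : ℕ))) := by
  rw [Triangle.step, dif_pos h]
  exact PMF.map_comp (fun ε : Fin 2 => (ε : ℕ)) _ (fun ε : ℕ => (s.1 - 1, s.2 - ε))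

/-- One step of the reversed chain, from the states of level `a + 1`. -/
theorem Triangle.tsum_step_le (c : Triangle) (a : ℕ) (g : ℕ → ℝ≥0∞) (s' : ℕ × ℕ) :
    ∑' k, (c.T (a + 1) k : ℝ≥0∞) * g k * c.step (a + 1, k) s' ≤
      if s'.1 = a then (c.T a s'.2 : ℝ≥0∞) * (g (s'.2 + 1) + c.b (a + 1) s'.2 * g s'.2) else 0 := by
  classical
  have hstep : ∀ k, (c.T (a + 1) k : ℝ≥0∞) * g k * c.step (a + 1, k) s' ≤
      (if s' = (a, k) then (c.b (a + 1) k * c.T a k : ℝ≥0∞) * g k else 0) +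
      (if s' = (a, k - 1) then (c.prevDiag (a + 1) k : ℝ≥0∞) * g k else 0) := by
    intro k
    -- The states made absorbing on this level carry weight `0`.
    by_cases hT : c.T (a + 1) k = 0
    · simp [hT]
    have hT' : (c.T (a + 1) k : ℝ≥0∞) ≠ 0 := by exact_mod_cast hT
    have hcancel : ∀ x : ℝ≥0∞, (c.T (a + 1) k : ℝ≥0∞) * g k * (x / c.T (a + 1) k) = x * g k := by
      intro x
      rw [mul_right_comm, ENNReal.mul_div_cancel hT' (ENNReal.natCast_ne_top _)]
    rw [c.step_eq ⟨Nat.succ_ne_zero a, hT⟩, PMF.map_apply, tsum_fintype,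
      Fin.sum_univ_two, mul_add]
    simp only [PMF.ofFintype_apply, Triangle.transProb, mul_ite, mul_zero, hcancel]
    refine le_of_eq ?_
    simp [Triangle.weight, Triangle.a]
  refine (ENNReal.tsum_le_tsum hstep).trans ?_
  rw [ENNReal.tsum_add]
  obtain ⟨a', k⟩ := s'
  by_cases ha : a' = a
  · subst ha
    rw [if_pos rfl, tsum_eq_single k (fun k' hk' => by simp [hk'.symm]),
      tsum_eq_single (k + 1) (fun k' hk' => ?_)]
    · simp [Triangle.prevDiag]
      refine le_of_eq ?_; ring
    · cases k' with
      | zero => simp [Triangle.prevDiag]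
      | succ k' => rw [if_neg]; simp; rintro rfl; exact hk' rfl
  · simp [ha]

/-- The marginals of the reversed chain are dominated by those of a forward chain. -/
theorem Forward.law_le {c : Triangle} (F : Forward c) {m l : ℕ} (hp : 0 < c.T m l * F.h m l)
    {n : ℕ} (hn : n ≤ m) (s : ℕ × ℕ) :
    c.law (m, l) n s ≤ if s.1 = m - n then
      ENNReal.ofReal (c.T s.1 s.2 * F.h s.1 s.2 / (c.T m l * F.h m l)) else 0 := by
  classical
  induction n generalizing s with
  | zero =>
    rw [Triangle.law, PMF.pure_apply]
    split_ifs with h1 h2 h2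
    · subst h1; simp [div_self hp.ne']
    · subst h1; simp at h2
    · exact zero_le
    · exact zero_le
  | succ n ih =>
    obtain ⟨a, rfl⟩ : ∃ a, m = a + 1 + n := ⟨m - n - 1, by lia⟩
    have ih := ih (by lia)
    rw [show a + 1 + n - n = a + 1 by lia] at ih
    rw [show a + 1 + n - (n + 1) = a by lia, Triangle.law, PMF.bind_apply]
    set Z := (c.T (a + 1 + n) l : ℝ) * F.h (a + 1 + n) l
    calc _ ≤ ∑' s' : ℕ × ℕ, (if s'.1 = a + 1 then
          ENNReal.ofReal (c.T s'.1 s'.2 * F.h s'.1 s'.2 / Z) else 0) * c.step s' s :=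
          ENNReal.tsum_le_tsum fun s' => mul_le_mul_left (ih s') _
      _ = ∑' k, (c.T (a + 1) k : ℝ≥0∞) * ENNReal.ofReal (F.h (a + 1) k / Z) *
            c.step (a + 1, k) s := by
          rw [ENNReal.tsum_prod', tsum_eq_single (a + 1) (fun a' ha' => by simp [ha'])]
          refine tsum_congr fun k => ?_
          rw [if_pos rfl, mul_div_assoc, ENNReal.ofReal_mul (Nat.cast_nonneg _),
            ENNReal.ofReal_natCast]
      _ ≤ _ := c.tsum_step_le a _ s
      _ = _ := by
          obtain ⟨a', k⟩ := s
          by_cases ha : a' = a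
          · subst ha
            simp only [if_true]
            have h0 : ∀ n k, 0 ≤ F.h n k / Z := fun n k => div_nonneg (F.h_nonneg n k) hp.le
            rw [mul_div_assoc, ENNReal.ofReal_mul (Nat.cast_nonneg _), ENNReal.ofReal_natCast,
              -- Harmonicity of `h` recombines the contributions of the two predecessors.
              ← F.harmonic a' k, add_div, mul_div_assoc,
              ENNReal.ofReal_add (h0 _ _) (mul_nonneg (Nat.cast_nonneg _) (h0 _ _)),
              ENNReal.ofReal_mul (Nat.cast_nonneg _), ENNReal.ofReal_natCast]
          · simp [ha]

open Classical in
/-- Large deviations of one coordinate of the reversed chain. -/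
theorem Forward.pathLaw_coord_le {c : Triangle} (F : Forward c) {m l : ℕ}
    (h : 1 ≤ ((m : ℝ) + 1) * (c.T m l * F.h m l)) {s : ℝ} (hs0 : 0 ≤ s) (hs : s ≤ 1)
    {j : ℕ} (hj : j ≤ m) :
    c.pathLaw m l {W | 2 * m * s ≤ |(levelX W j : ℝ) - F.μ j|} ≤
      ENNReal.ofReal (2 * ((m : ℝ) + 1) * Real.exp (-(m * s ^ 2))) := by
  have hp : 0 < c.T m l * F.h m l := by
    by_contra! hc
    nlinarith
  set Z := (c.T m l : ℝ) * F.h m l with hZ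
  let i : Fin (m + 1) := ⟨m - j, Nat.lt_succ_of_le (Nat.sub_le m j)⟩
  have hset : {W : Fin (m + 1) → ℕ × ℕ | 2 * m * s ≤ |(levelX W j : ℝ) - F.μ j|} =
      (fun W => W i) ⁻¹' {p : ℕ × ℕ | 2 * m * s ≤ |(p.2 : ℝ) - F.μ j|} := rfl
  rw [hset, Triangle.pathLaw, ← PMF.toMeasure_map_apply _ _ _ (measurable_pi_apply i)
    (Set.to_countable _).measurableSet, c.chain_map,
    PMF.toMeasure_apply _ (Set.to_countable _).measurableSet]
  have hmj : m - (i : ℕ) = j := by simp only [i]; lia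
  calc _ ≤ ∑' p : ℕ × ℕ, if p.1 = j then
          ENNReal.ofReal ((if 2 * m * s ≤ |(p.2 : ℝ) - F.μ j| then
            (c.T j p.2 : ℝ) * F.h j p.2 else 0) / Z) else 0 := by
        refine ENNReal.tsum_le_tsum fun p => ?_
        have := F.law_le hp (Nat.lt_succ_iff.1 i.2) p
        rw [hmj] at this
        by_cases hb : p ∈ {p : ℕ × ℕ | 2 * m * s ≤ |(p.2 : ℝ) - F.μ j|}
        · rw [Set.indicator_of_mem hb]
          rw [Set.mem_ofPred_eq] at hb
          refine this.trans (le_of_eq ?_)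
          by_cases hpj : p.1 = j
          · simp only [hpj, hb, if_true]; rfl
          · simp only [hpj, if_false]
        · rw [Set.indicator_of_notMem hb]; exact zero_le
    _ = ∑' k : ℕ, ENNReal.ofReal ((if 2 * m * s ≤ |(k : ℝ) - F.μ j| then
            (c.T j k : ℝ) * F.h j k else 0) / Z) := by
        rw [ENNReal.tsum_prod', tsum_eq_single j (fun a' ha' => by simp [ha'])]
        simp
    _ = ∑ k ∈ Finset.range (j + 1), ENNReal.ofReal ((if 2 * m * s ≤ |(k : ℝ) - F.μ j| then
            (c.T j k : ℝ) * F.h j k else 0) / Z) := by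
        refine tsum_eq_sum fun k hk => ?_
        rw [c.T_eq_zero (show j < k by simpa using hk)]
        simp
    _ = ENNReal.ofReal ((∑ k ∈ Finset.range (j + 1), if 2 * m * s ≤ |(k : ℝ) - F.μ j| then
            (c.T j k : ℝ) * F.h j k else 0) / Z) := by
        rw [← ENNReal.ofReal_sum_of_nonneg, Finset.sum_div]
        intro k _
        refine div_nonneg ?_ hp.le
        split_ifs
        · exact mul_nonneg (Nat.cast_nonneg _) (F.h_nonneg j k)
        · exact le_rfl
    _ ≤ _ := by
        refine ENNReal.ofReal_le_ofReal ?_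
        rw [div_le_iff₀ hp]
        refine (F.tail_le hj hs0 hs).trans ?_
        have := mul_le_mul_of_nonneg_left h (by positivity : 0 ≤ 2 * Real.exp (-(m * s ^ 2)))
        linarith

/-! ### Profiles and their curves -/

/-- `I` is the primitive vanishing at `0` of a positive strictly decreasing function `D` on
`[0,∞)` with `D 0 = 1`, and `I(w)/w` takes arbitrarily small values. -/
structure Profile (I D : ℝ → ℝ) : Prop where
  zero : I 0 = 0
  one : D 0 = 1
  deriv : ∀ w, 0 ≤ w → HasStrictDerivAt I (D w) w
  anti : StrictAntiOn D (Ici 0)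
  pos : ∀ w, 0 ≤ w → 0 < D w
  cont : ContinuousOn D (Ici 0)
  decay : ∀ a, 0 < a → ∃ w, 0 < w ∧ I w ≤ a * w

/-- If `f` and `g` agree at `0` and `f' ≤ g'`, then on `[0,1]` their distance is largest at `1`. -/
theorem abs_sub_le_of_deriv_le {f g f' g' : ℝ → ℝ} (h0 : f 0 = g 0)
    (hf : ∀ t, 0 ≤ t → HasDerivAt f (f' t) t) (hg : ∀ t, 0 ≤ t → HasDerivAt g (g' t) t)
    (hle : ∀ t, 0 ≤ t → f' t ≤ g' t) {t : ℝ} (ht0 : 0 ≤ t) (ht1 : t ≤ 1) :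
    |f t - g t| ≤ |f 1 - g 1| := by
  have hm : MonotoneOn (fun t => g t - f t) (Ici 0) := by
    refine monotoneOn_of_deriv_nonneg (convex_Ici 0)
      (fun x hx => ((hg x hx).sub (hf x hx)).continuousAt.continuousWithinAt)
      (fun x hx => ?_) (fun x hx => ?_) <;> rw [interior_Ici] at hx
    · exact ((hg x (le_of_lt hx)).sub (hf x (le_of_lt hx))).differentiableAt.differentiableWithinAt
    · rw [((hg x (le_of_lt hx)).fun_sub (hf x (le_of_lt hx))).deriv]
      exact sub_nonneg.2 (hle x (le_of_lt hx))
  have h1 := hm (mem_Ici.2 le_rfl) (mem_Ici.2 ht0) ht0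
  have h2 := hm (mem_Ici.2 ht0) (mem_Ici.2 zero_le_one) ht1
  simp only [h0, sub_self] at h1 h2
  rw [abs_sub_comm, abs_sub_comm (f 1), abs_of_nonneg h1, abs_of_nonneg (h1.trans h2)]
  exact h2

/-- The curve with slope `D (v t)` at `t`. -/
def curve (I : ℝ → ℝ) (v t : ℝ) : ℝ := I (v * t) / v

namespace Profile

variable {I D : ℝ → ℝ} (P : Profile I D)
include P

theorem le_one {w : ℝ} (hw : 0 ≤ w) : D w ≤ 1 := by
  rw [← P.one]; exact P.anti.antitoneOn (mem_Ici.2 le_rfl) (mem_Ici.2 hw) hw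

theorem exists_slope {w : ℝ} (hw : 0 < w) : ∃ x, 0 < x ∧ x < w ∧ I w = D x * w := by
  obtain ⟨x, hx, h⟩ := exists_hasDerivAt_eq_slope I D hw
    (fun x hx => (P.deriv x hx.1).hasDerivAt.continuousAt.continuousWithinAt)
    (fun x hx => (P.deriv x hx.1.le).hasDerivAt)
  refine ⟨x, hx.1, hx.2, ?_⟩
  rw [h, P.zero, sub_zero, sub_zero, div_mul_cancel₀ _ hw.ne']

theorem mul_lt {w : ℝ} (hw : 0 < w) : w * D w < I w := by
  obtain ⟨x, h0, h1, h⟩ := P.exists_slope hw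
  rw [h, mul_comm]
  exact mul_lt_mul_of_pos_right (P.anti (mem_Ici.2 h0.le) (mem_Ici.2 hw.le) h1) hw

theorem lt_self {w : ℝ} (hw : 0 < w) : I w < w := by
  obtain ⟨x, h0, h1, h⟩ := P.exists_slope hw
  have := P.anti (mem_Ici.2 le_rfl) (mem_Ici.2 h0.le) h0
  rw [P.one] at this
  rw [h]; nlinarith

theorem I_pos {w : ℝ} (hw : 0 < w) : 0 < I w :=
  (mul_pos hw (P.pos w hw.le)).trans (P.mul_lt hw)

theorem hasStrictDerivAt_ratio {w : ℝ} (hw : 0 < w) :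
    HasStrictDerivAt (fun w => I w / w) ((D w * w - I w) / w ^ 2) w := by
  simpa using (P.deriv w hw.le).fun_div (hasStrictDerivAt_id w) hw.ne'

/-- As `D` decreases, its mean over `[0,w]` exceeds `D w`. Injectivity of the ratio lets `w` serve
as a coordinate for `y/x`. -/
theorem ratio_strictAnti : StrictAntiOn (fun w => I w / w) (Ioi 0) := by
  refine strictAntiOn_of_deriv_neg (convex_Ioi 0)
    (fun w hw => (P.hasStrictDerivAt_ratio hw).hasDerivAt.continuousAt.continuousWithinAt)
    (fun w hw => ?_)
  rw [interior_Ioi] at hw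
  have hw : 0 < w := hw
  rw [(P.hasStrictDerivAt_ratio hw).hasDerivAt.deriv]
  exact div_neg_of_neg_of_pos (by linarith [P.mul_lt hw]) (by positivity)

theorem existsUnique {a : ℝ} (h0 : 0 < a) (h1 : a < 1) : ∃! w, 0 < w ∧ I w = a * w := by
  obtain ⟨v, hv, hva⟩ := P.decay a h0
  obtain ⟨u, hu, hua⟩ : ∃ u, 0 < u ∧ a < D u := by
    have hc : ContinuousWithinAt D (Ioi 0) 0 :=
      (P.cont 0 (mem_Ici.2 le_rfl)).mono Ioi_subset_Ici_self
    have := hc.eventually (lt_mem_nhds (show a < D 0 by rwa [P.one]))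
    obtain ⟨u, h, hu⟩ := (this.and self_mem_nhdsWithin).exists
    exact ⟨u, hu, h⟩
  have hcont : ContinuousOn (fun w => I w / w) (Ioi 0) := fun w hw =>
    (P.hasStrictDerivAt_ratio hw).hasDerivAt.continuousAt.continuousWithinAt
  obtain ⟨w, hw, h⟩ : ∃ w ∈ Ioi (0 : ℝ), I w / w = a := by
    refine isPreconnected_Ioi.intermediate_value (mem_Ioi.2 hv) (mem_Ioi.2 hu) hcont ⟨?_, ?_⟩
    · exact (div_le_iff₀ hv).2 hva
    · exact (le_div_iff₀ hu).2 (by nlinarith [P.mul_lt hu])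
  have hw : 0 < w := hw
  refine ⟨w, ⟨hw, by rw [← h]; field_simp⟩, fun w' ⟨hw', h'⟩ => ?_⟩
  refine P.ratio_strictAnti.injOn (mem_Ioi.2 hw') (mem_Ioi.2 hw) ?_
  simp only [h, h']
  field_simp

theorem hasDerivAt_curve {v t : ℝ} (hv : 0 < v) (ht : 0 ≤ t) :
    HasDerivAt (curve I v) (D (v * t)) t := by
  have h1 : HasDerivAt (fun t => v * t) v t := by simpa using (hasDerivAt_id t).const_mul v
  have := ((P.deriv (v * t) (by positivity)).hasDerivAt.comp t h1).div_const v
  rw [mul_div_cancel_right₀ _ hv.ne'] at this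
  exact this

theorem curve_zero (v : ℝ) : curve I v 0 = 0 := by simp [curve, P.zero]

/-- All curves start at `0`, and a larger parameter gives a smaller slope at every time, so the gap
only grows. -/
theorem abs_curve_sub_curve_le {u v t : ℝ} (hu : 0 < u) (hv : 0 < v) (ht0 : 0 ≤ t)
    (ht1 : t ≤ 1) : |curve I u t - curve I v t| ≤ |curve I u 1 - curve I v 1| := by
  wlog huv : v ≤ u generalizing u v
  · rw [abs_sub_comm, abs_sub_comm (curve I u 1)]
    exact this hv hu (le_of_not_ge huv)
  exact abs_sub_le_of_deriv_le (by rw [P.curve_zero, P.curve_zero])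
    (fun t ht => P.hasDerivAt_curve hu ht) (fun t ht => P.hasDerivAt_curve hv ht)
    (fun t ht => P.anti.antitoneOn (mem_Ici.2 (by positivity)) (mem_Ici.2 (by positivity))
      (mul_le_mul_of_nonneg_right huv ht)) ht0 ht1

theorem abs_curve_sub_le {v s t : ℝ} (hv : 0 < v) (hs : 0 ≤ s) (ht : 0 ≤ t) :
    |curve I v t - curve I v s| ≤ |t - s| := by
  have := (convex_Ici (0 : ℝ)).norm_image_sub_le_of_norm_hasDerivWithin_le (f := curve I v)
    (f' := fun t => D (v * t)) (C := 1)
    (fun x hx => (P.hasDerivAt_curve hv hx).hasDerivWithinAt)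
    (fun x hx => by
      have hx : 0 ≤ v * x := mul_nonneg hv.le hx
      rw [Real.norm_eq_abs, abs_of_pos (P.pos _ hx)]
      exact P.le_one hx) (mem_Ici.2 hs) (mem_Ici.2 ht)
  simpa using this

theorem curve_pos {v x : ℝ} (hv : 0 < v) (hx : 0 < x) : 0 < curve I v x :=
  div_pos (P.I_pos (mul_pos hv hx)) hv

theorem curve_lt {v x : ℝ} (hv : 0 < v) (hx : 0 < x) : curve I v x < x := by
  rw [curve, div_lt_iff₀ hv, mul_comm x]
  exact P.lt_self (mul_pos hv hx)

/-- If `w x > 0` solves `I (w x) / w x = y x / x` and `y' = D (w x)`, then `w x / x` is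
stationary. -/
theorem hasDerivWithinAt_param {w y : ℝ → ℝ} {s : Set ℝ} {x : ℝ}
    (hxs : x ∈ s) (hs : s ∈ 𝓝[s] x) (hx : ∀ z ∈ s, 0 < z)
    (hw : ∀ z ∈ s, 0 < w z ∧ I (w z) / w z = y z / z)
    (hy : HasDerivWithinAt y (D (w x)) s x) :
    HasDerivWithinAt (fun z => w z / z) 0 s x := by
  have hx0 := hx x hxs
  obtain ⟨hw0, hwx⟩ := hw x hxs
  have hG := P.hasStrictDerivAt_ratio hw0
  have hne : (D (w x) * w x - I (w x)) / w x ^ 2 ≠ 0 :=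
    div_ne_zero (by linarith [P.mul_lt hw0]) (by positivity)
  -- No regularity of `w` is assumed; it is obtained by expressing `w` near `x` as a local inverse
  -- of the ratio applied to `y z / z`.
  set g := hG.localInverse _ _ _ hne with hg
  have hgd : HasStrictDerivAt g ((D (w x) * w x - I (w x)) / w x ^ 2)⁻¹ (I (w x) / w x) :=
    hG.to_localInverse hne
  have hgx : g (I (w x) / w x) = w x :=
    HasStrictFDerivAt.localInverse_apply_image (hG.hasStrictFDerivAt_equiv hne)
  have hgr : ∀ᶠ a in 𝓝 (I (w x) / w x), I (g a) / g a = a :=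
    HasStrictFDerivAt.eventually_right_inverse (hG.hasStrictFDerivAt_equiv hne)
  have hgp : ∀ᶠ a in 𝓝 (I (w x) / w x), 0 < g a :=
    hgd.hasDerivAt.continuousAt.eventually (lt_mem_nhds (by rwa [hgx]))
  have hyx : HasDerivWithinAt (fun z => y z / z) ((D (w x) * x - y x) / x ^ 2) s x := by
    simpa using hy.fun_div (hasDerivWithinAt_id x s) hx0.ne'
  rw [hwx] at hgd hgr hgp
  have hcomp := HasDerivAt.comp_hasDerivWithinAt (h := fun z => y z / z) x hgd.hasDerivAt hyx
  have hEq : w =ᶠ[𝓝[s] x] g ∘ fun z => y z / z := by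
    filter_upwards [hs, hyx.continuousWithinAt.eventually hgr,
      hyx.continuousWithinAt.eventually hgp] with z hz h1 h2
    refine P.ratio_strictAnti.injOn (mem_Ioi.2 (hw z hz).1) (mem_Ioi.2 h2) ?_
    simp only [Function.comp_apply]
    rw [h1, (hw z hz).2]
  have hwd := hcomp.congr_of_eventuallyEq hEq (hEq.self_of_nhdsWithin hxs)
  have hI : I (w x) = y x / x * w x := by rw [← hwx]; field_simp
  have hne' : D (w x) * x - y x ≠ 0 := by
    intro h0
    apply hne
    rw [hI]; field_simp; rw [h0]; simp
  -- The derivative of `w` is `w x / x`, hence that of `w z / z` vanishes.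
  have hval : ((D (w x) * w x - I (w x)) / w x ^ 2)⁻¹ * ((D (w x) * x - y x) / x ^ 2) =
      w x / x := by
    have : (D (w x) * w x - I (w x)) / w x ^ 2 = (D (w x) * x - y x) / (x * w x) := by
      rw [hI]; field_simp
    rw [this]; field_simp
  rw [hval] at hwd
  have := hwd.fun_div (hasDerivWithinAt_id x s) hx0.ne'
  simpa [hx0.ne'] using this

end Profile

/-! ### Field lines in the parametrized cases -/

/-- The limit slope and the curves of a triangle come from a profile, through a parameter
solving `I (par r) / par r = 1 / (1 + r)`. -/
structure Triangle.Param (c : Triangle) (I D par : ℝ → ℝ) : Prop where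
  prof : Profile I D
  par_pos : ∀ r, 0 < r → 0 < par r
  par_eq : ∀ r, 0 < r → I (par r) = 1 / (1 + r) * par r
  phi_eq : ∀ r, 0 < r → c.phi r = D (par r)
  gamma_eq : ∀ r t, 0 < r → c.gamma r t = curve I (par r) t

namespace Triangle.Param

variable {c : Triangle} {I D par : ℝ → ℝ} (H : c.Param I D par)
include H

theorem curve_one {r : ℝ} (hr : 0 < r) : curve I (par r) 1 = 1 / (1 + r) := by
  have := H.par_pos r hr
  rw [curve, mul_one, H.par_eq r hr]; field_simp

theorem ratio_eq {x y : ℝ} (hy : 0 < y) (hyx : y < x) :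
    I (par ((x - y) / y)) / par ((x - y) / y) = y / x := by
  have hr : 0 < (x - y) / y := div_pos (sub_pos.2 hyx) hy
  have := H.par_pos _ hr
  have hx : 0 < x := hy.trans hyx
  rw [H.par_eq _ hr, mul_div_cancel_right₀ _ this.ne',
    show 1 + (x - y) / y = x / y by field_simp; ring, one_div_div]

theorem isFieldLine {r B : ℝ} (hr : 0 < r) : c.IsFieldLine r B (c.gamma r) := by
  have hv := H.par_pos r hr
  have hfun : c.gamma r = curve I (par r) := funext fun t => H.gamma_eq r t hr
  rw [hfun]
  refine ⟨fun x hx => (H.prof.hasDerivAt_curve hv hx.1).continuousAt.continuousWithinAt,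
    H.curve_one hr, fun x hx => ⟨H.prof.curve_pos hv hx.1, H.prof.curve_lt hv hx.1, ?_⟩⟩
  have hy := H.prof.curve_pos hv hx.1
  have hyx := H.prof.curve_lt hv hx.1
  have hl : 0 < (x - curve I (par r) x) / curve I (par r) x := div_pos (sub_pos.2 hyx) hy
  have hw : par ((x - curve I (par r) x) / curve I (par r) x) = par r * x := by
    refine H.prof.ratio_strictAnti.injOn (mem_Ioi.2 (H.par_pos _ hl))
      (mem_Ioi.2 (mul_pos hv hx.1)) ?_
    rw [H.ratio_eq hy hyx, curve, div_div]
  rw [H.phi_eq _ hl, hw]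
  exact (H.prof.hasDerivAt_curve hv hx.1.le).hasDerivWithinAt

/-- The stationary quantity `w x / x` equals `par r` at `x = 1`, hence everywhere; `y` is then read
off from `I (w x) / w x = y x / x`. -/
theorem eqOn_Ioc {r B : ℝ} (hr : 0 < r) (hB : 1 ≤ B) {y : ℝ → ℝ} (hy : c.IsFieldLine r B y) :
    EqOn y (c.gamma r) (Ioc 0 B) := by
  obtain ⟨-, h1, hd⟩ := hy
  set w : ℝ → ℝ := fun x => par ((x - y x) / y x) with hw
  have hl : ∀ x ∈ Ioc 0 B, 0 < (x - y x) / y x := fun x hx =>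
    div_pos (sub_pos.2 (hd x hx).2.1) (hd x hx).1
  have hws : ∀ x ∈ Ioc 0 B, 0 < w x ∧ I (w x) / w x = y x / x := fun x hx =>
    ⟨H.par_pos _ (hl x hx), H.ratio_eq (hd x hx).1 (hd x hx).2.1⟩
  have hderiv : ∀ x ∈ Ioc 0 B, HasDerivWithinAt (fun z => w z / z) 0 (Ioc 0 B) x := fun x hx => by
    refine H.prof.hasDerivWithinAt_param hx self_mem_nhdsWithin (fun z hz => hz.1) hws ?_
    rw [← H.phi_eq _ (hl x hx)]
    exact (hd x hx).2.2.mono Ioc_subset_Icc_self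
  have hone : (1 : ℝ) ∈ Ioc 0 B := ⟨one_pos, hB⟩
  have hw1 : w 1 = par r := by
    have : (1 - y 1) / y 1 = r := by
      rw [h1]; field_simp; ring
    rw [hw]; simp only [this]
  intro x hx
  have hx0 := hx.1
  have hconst := (convex_Ioc 0 B).norm_image_sub_le_of_norm_hasDerivWithin_le (C := 0) hderiv
    (fun x _ => by simp) hone hx
  have hwx : w x = par r * x := by
    have : w x / x = par r := by
      rw [zero_mul, norm_le_zero_iff, sub_eq_zero, div_one, hw1] at hconst
      exact hconst
    rw [← this, div_mul_cancel₀ _ hx0.ne']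
  have := (hws x hx).2
  have hv := H.par_pos r hr
  rw [hwx] at this
  rw [H.gamma_eq r x hr, curve, eq_div_iff hv.ne']
  field_simp at this
  linarith

theorem abs_gamma_sub_gamma_le {r r' t : ℝ} (hr : 0 < r) (hr' : 0 < r') (ht0 : 0 ≤ t)
    (ht1 : t ≤ 1) : |c.gamma r t - c.gamma r' t| ≤ |1 / (1 + r) - 1 / (1 + r')| := by
  rw [H.gamma_eq r t hr, H.gamma_eq r' t hr', ← H.curve_one hr, ← H.curve_one hr']
  exact H.prof.abs_curve_sub_curve_le (H.par_pos r hr) (H.par_pos r' hr') ht0 ht1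

/-- If a discrete path is close to a curve of the family, it is close to the one with the same
end point. -/
theorem abs_sub_gamma_le {r m v C x : ℝ} (hr : 0 < r) (hv : 0 < v) (hm : 0 < m)
    {f : ℕ → ℝ} {j n : ℕ} (hn : m = n) (hj : j ≤ n)
    (hf : ∀ j, j ≤ n → |f j - m * curve I v (j / m)| ≤ C) (hx : m / (1 + r) = x) :
    |f j - m * c.gamma r (j / m)| ≤ 2 * C + |x - f n| := by
  have h1 := hf j hj
  have h2 := hf n le_rfl
  have ht0 : (0 : ℝ) ≤ j / m := by positivity
  have ht1 : (j : ℝ) / m ≤ 1 := by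
    rw [div_le_one hm, hn]; exact_mod_cast hj
  have h3 := H.prof.abs_curve_sub_curve_le hv (H.par_pos r hr) ht0 ht1
  rw [H.curve_one hr] at h3
  have h4 := mul_le_mul_of_nonneg_left h3 hm.le
  rw [← hn, div_self hm.ne'] at h2
  rw [← abs_of_pos hm, ← abs_mul, ← abs_mul, abs_of_pos hm, mul_sub, mul_sub, mul_one_div, hx]
    at h4
  have h5 : |m * curve I v 1 - x| ≤ C + |x - f n| := by
    rw [show m * curve I v 1 - x = -(f n - m * curve I v 1) - (x - f n) by ring]
    refine (abs_sub _ _).trans ?_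
    rw [abs_neg]; linarith
  rw [H.gamma_eq r _ hr]
  calc _ ≤ |f j - m * curve I v (j / m)| +
        |m * curve I v (j / m) - m * curve I (par r) (j / m)| := abs_sub_le _ _ _
    _ ≤ _ := by linarith

end Triangle.Param

/-! ### Field lines of the three triangles -/

theorem profile_second : Profile (fun w => 1 - Real.exp (-w)) (fun w => Real.exp (-w)) where
  zero := by simp
  one := by simp
  deriv w _ := by
    simpa using ((hasStrictDerivAt_id w).fun_neg.exp).const_sub 1
  anti := fun x _ y _ h => Real.exp_lt_exp.2 (neg_lt_neg h)
  pos w _ := Real.exp_pos _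
  cont := by fun_prop
  decay a ha := ⟨a⁻¹, inv_pos.2 ha, by
    rw [mul_inv_cancel₀ ha.ne']; linarith [Real.exp_pos (-a⁻¹)]⟩

theorem profile_first : Profile (fun w => Real.log (1 + w)) (fun w => 1 / (1 + w)) where
  zero := by simp
  one := by simp
  deriv w hw := by
    simpa using ((hasStrictDerivAt_id w).const_add 1).log (by simp; linarith)
  anti := fun x hx y _ h => by
    have hx : 0 ≤ x := hx
    exact one_div_lt_one_div_of_lt (by linarith) (by linarith)
  pos w hw := by positivity
  cont := fun w hw => by
    have hw : 0 ≤ w := hw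
    have : 1 + w ≠ 0 := by linarith
    exact (ContinuousAt.div (by fun_prop) (by fun_prop) this).continuousWithinAt
  decay a ha := by
    -- Chosen so that `1 + w = (1 + 2/a)²`: then `log(1 + w) ≤ 4/a`, while `a * w = 4/a + 4`.
    refine ⟨(2 / a) ^ 2 + 2 * (2 / a), by positivity, ?_⟩
    have h : 0 < 2 / a := by positivity
    rw [show 1 + ((2 / a) ^ 2 + 2 * (2 / a)) = (1 + 2 / a) ^ 2 by ring, Real.log_pow]
    have := Real.log_le_sub_one_of_pos (show 0 < 1 + 2 / a by positivity)
    rw [show a * ((2 / a) ^ 2 + 2 * (2 / a)) = 4 / a + 4 by field_simp; ring]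
    have h4 : 4 / a = 2 * (2 / a) := by ring
    push_cast; linarith

theorem isZeta2_iff {r z : ℝ} (hr : 0 < r) :
    IsZeta2 r z ↔ 0 < z ∧ 1 - Real.exp (-z) = 1 / (1 + r) * z := by
  refine and_congr_right fun hz => ?_
  have : Real.exp (-z) < 1 := Real.exp_lt_one_iff.2 (by linarith)
  rw [div_eq_iff (by linarith), one_div, eq_inv_mul_iff_mul_eq₀ (by linarith)]
  exact eq_comm

/-- The substitution `w = z/(1-z)`, for which `1 + w = 1/(1-z)`, brings the equation to the profile
`log(1 + w)`. -/
theorem isZeta3_iff {r z : ℝ} (hr : 0 < r) :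
    IsZeta3 r z ↔ z < 1 ∧ 0 < z / (1 - z) ∧
      Real.log (1 + z / (1 - z)) = 1 / (1 + r) * (z / (1 - z)) := by
  rw [IsZeta3, ← and_assoc, and_comm (a := 0 < z), and_assoc]
  refine and_congr_right fun h1 => ?_
  have h1' : 0 < 1 - z := by linarith
  rw [div_pos_iff_of_pos_right h1']
  refine and_congr_right fun hz => ?_
  have hlog : Real.log (1 + z / (1 - z)) = -Real.log (1 - z) := by
    rw [← Real.log_inv]; congr 1; field_simp; ring
  have hneg : Real.log (1 - z) < 0 := Real.log_neg h1' (by linarith)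
  rw [hlog, div_eq_iff (mul_pos_of_neg_of_neg (by linarith) hneg).ne', one_div,
    eq_inv_mul_iff_mul_eq₀ (by linarith), eq_div_iff h1'.ne', eq_comm]
  constructor <;> intro h <;> linarith

theorem one_div_one_add_mem {r : ℝ} (hr : 0 < r) : 0 < 1 / (1 + r) ∧ 1 / (1 + r) < 1 :=
  ⟨by positivity, by rw [div_lt_one (by linarith)]; linarith⟩

theorem existsUnique_isZeta2 {r : ℝ} (hr : 0 < r) : ∃! z, IsZeta2 r z := by
  simp only [isZeta2_iff hr]
  exact profile_second.existsUnique (one_div_one_add_mem hr).1 (one_div_one_add_mem hr).2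

theorem existsUnique_isZeta3 {r : ℝ} (hr : 0 < r) : ∃! z, IsZeta3 r z := by
  simp only [isZeta3_iff hr]
  obtain ⟨v, ⟨hv, h⟩, huniq⟩ :=
    profile_first.existsUnique (one_div_one_add_mem hr).1 (one_div_one_add_mem hr).2
  have hvz : v / (1 + v) / (1 - v / (1 + v)) = v := by
    rw [show 1 - v / (1 + v) = 1 / (1 + v) by field_simp; ring]; field_simp
  refine ⟨v / (1 + v), ⟨?_, ?_, ?_⟩, fun z ⟨hz1, hz⟩ => ?_⟩
  · rw [div_lt_one (by linarith)]; linarith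
  · rwa [hvz]
  · rwa [hvz]
  · rw [← huniq _ hz]
    have : 1 - z ≠ 0 := by linarith
    rw [show 1 + z / (1 - z) = 1 / (1 - z) by field_simp; ring]
    field_simp

theorem isZeta2_zeta2 {r : ℝ} (hr : 0 < r) : IsZeta2 r (zeta2 r) :=
  Classical.epsilon_spec (existsUnique_isZeta2 hr).exists

theorem isZeta3_zeta3 {r : ℝ} (hr : 0 < r) : IsZeta3 r (zeta3 r) :=
  Classical.epsilon_spec (existsUnique_isZeta3 hr).exists

theorem param_second : Triangle.stirlingSecond.Param (fun w => 1 - Real.exp (-w))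
    (fun w => Real.exp (-w)) zeta2 where
  prof := profile_second
  par_pos _ hr := (isZeta2_zeta2 hr).1
  par_eq _ hr := ((isZeta2_iff hr).1 (isZeta2_zeta2 hr)).2
  phi_eq _ _ := rfl
  gamma_eq r t _ := by simp only [Triangle.gamma, curve, mul_comm t]

theorem param_first : Triangle.stirlingFirst.Param (fun w => Real.log (1 + w))
    (fun w => 1 / (1 + w)) (fun r => zeta3 r / (1 - zeta3 r)) where
  prof := profile_first
  par_pos _ hr := ((isZeta3_iff hr).1 (isZeta3_zeta3 hr)).2.1
  par_eq _ hr := ((isZeta3_iff hr).1 (isZeta3_zeta3 hr)).2.2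
  phi_eq r hr := by
    obtain ⟨h0, h1, -⟩ := isZeta3_zeta3 hr
    have : 1 - zeta3 r ≠ 0 := by linarith
    rw [show 1 + zeta3 r / (1 - zeta3 r) = 1 / (1 - zeta3 r) by field_simp; ring, one_div_one_div]
    rfl
  gamma_eq r t hr := by
    obtain ⟨h0, h1, -⟩ := isZeta3_zeta3 hr
    have : 1 - zeta3 r ≠ 0 := by linarith
    simp only [Triangle.gamma, curve]
    rw [show 1 + zeta3 r / (1 - zeta3 r) * t = (1 - zeta3 r + t * zeta3 r) / (1 - zeta3 r) by
      field_simp, div_eq_mul_inv _ (zeta3 r / (1 - zeta3 r)), inv_div, mul_comm]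

namespace Triangle

theorem isFieldLine_pascal {r B : ℝ} (hr : 0 < r) : pascal.IsFieldLine r B (pascal.gamma r) := by
  refine ⟨by unfold gamma; fun_prop, by simp [gamma], fun x hx => ?_⟩
  have hx0 := hx.1
  have h1 : pascal.gamma r x = x / (1 + r) := rfl
  refine ⟨by rw [h1]; positivity, by rw [h1, div_lt_iff₀ (by linarith)]; nlinarith, ?_⟩
  have h2 : pascal.phi ((x - pascal.gamma r x) / pascal.gamma r x) = 1 / (1 + r) := by
    rw [h1]; simp only [phi]
    rw [show (x - x / (1 + r)) / (x / (1 + r)) = r by field_simp; ring]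
  rw [h2]
  exact ((hasDerivAt_id x).div_const (1 + r)).hasDerivWithinAt

/-- Here the slope is `y/x` itself, so `y/x` is constant. These rays do not come from a profile,
whose curves all have slope `1` at `0`. -/
theorem eqOn_Ioc_pascal {r B : ℝ} (hB : 1 ≤ B) {y : ℝ → ℝ} (hy : pascal.IsFieldLine r B y) :
    EqOn y (pascal.gamma r) (Ioc 0 B) := by
  obtain ⟨-, h1, hd⟩ := hy
  have hderiv : ∀ x ∈ Ioc 0 B, HasDerivWithinAt (fun z => y z / z) 0 (Ioc 0 B) x := fun x hx => by
    obtain ⟨hy0, hyx, h⟩ := hd x hx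
    have hx0 := hx.1
    have h2 : pascal.phi ((x - y x) / y x) = y x / x := by
      simp only [phi]
      rw [show 1 + (x - y x) / y x = x / y x by field_simp; ring, one_div_div]
    rw [h2] at h
    have := (h.mono Ioc_subset_Icc_self).fun_div (hasDerivWithinAt_id x _) hx0.ne'
    simpa [hx0.ne'] using this
  intro x hx
  have hx0 := hx.1
  have hconst := (convex_Ioc 0 B).norm_image_sub_le_of_norm_hasDerivWithin_le (C := 0) hderiv
    (fun x _ => by simp) ⟨one_pos, hB⟩ hx
  rw [zero_mul, norm_le_zero_iff, sub_eq_zero, div_one, h1, div_eq_iff hx0.ne'] at hconst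
  rw [hconst]; simp only [gamma]; ring

theorem isFieldLine_gamma (c : Triangle) {r B : ℝ} (hr : 0 < r) :
    c.IsFieldLine r B (c.gamma r) := by
  cases c
  · exact isFieldLine_pascal hr
  · exact param_second.isFieldLine hr
  · exact param_first.isFieldLine hr

theorem eqOn_gamma (c : Triangle) {r B : ℝ} (hr : 0 < r) (hB : 1 ≤ B) {y : ℝ → ℝ}
    (hy : c.IsFieldLine r B y) : EqOn y (c.gamma r) (Icc 0 B) := by
  have h : EqOn y (c.gamma r) (Ioc 0 B) := by
    cases c
    · exact eqOn_Ioc_pascal hB hy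
    · exact param_second.eqOn_Ioc hr hB hy
    · exact param_first.eqOn_Ioc hr hB hy
  refine h.of_subset_closure hy.1 (c.isFieldLine_gamma (B := B) hr).1 Ioc_subset_Icc_self ?_
  rw [closure_Ioc (by linarith)]

theorem abs_gamma_sub_gamma_le (c : Triangle) {r r' t : ℝ} (hr : 0 < r) (hr' : 0 < r')
    (ht0 : 0 ≤ t) (ht1 : t ≤ 1) :
    |c.gamma r t - c.gamma r' t| ≤ |r - r'| := by
  have h : |c.gamma r t - c.gamma r' t| ≤ |1 / (1 + r) - 1 / (1 + r')| := by
    cases c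
    · simp only [gamma]
      rw [show t / (1 + r) - t / (1 + r') = t * (1 / (1 + r) - 1 / (1 + r')) by ring, abs_mul,
        abs_of_nonneg ht0]
      exact mul_le_of_le_one_left (abs_nonneg _) ht1
    · exact param_second.abs_gamma_sub_gamma_le hr hr' ht0 ht1
    · exact param_first.abs_gamma_sub_gamma_le hr hr' ht0 ht1
  refine h.trans ?_
  rw [div_sub_div _ _ (by linarith) (by linarith), abs_div, abs_sub_comm r]
  refine div_le_of_le_mul₀ (abs_nonneg _) (abs_nonneg _) ?_
  rw [show 1 * (1 + r') - (1 + r) * 1 = r' - r by ring]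
  refine le_mul_of_one_le_right (abs_nonneg _) ?_
  rw [abs_of_pos (by positivity)]
  nlinarith [mul_pos hr hr']

theorem abs_gamma_sub_le (c : Triangle) {r s t : ℝ} (hr : 0 < r) (hs : 0 ≤ s) (ht : 0 ≤ t) :
    |c.gamma r t - c.gamma r s| ≤ |t - s| := by
  cases c
  · simp only [gamma]
    rw [← sub_div, abs_div, abs_of_pos (by linarith : 0 < 1 + r)]
    exact div_le_self (abs_nonneg _) (by linarith)
  · rw [param_second.gamma_eq r t hr, param_second.gamma_eq r s hr]
    exact profile_second.abs_curve_sub_le (param_second.par_pos r hr) hs ht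
  · rw [param_first.gamma_eq r t hr, param_first.gamma_eq r s hr]
    exact profile_first.abs_curve_sub_le (param_first.par_pos r hr) hs ht

end Triangle

/-! ### The three forward chains and the choice of parameter -/

namespace Forward

theorem le_mode {c : Triangle} (F : Forward c) {m l : ℕ} (hlm : l ≤ m) (hl1 : 1 ≤ l)
    (hlc : ∀ k, F.h m k * F.h m (k + 2) ≤ F.h m (k + 1) ^ 2) (hpos : ∀ k ≤ l, 0 < F.h m k)
    (hzero : ∀ k, F.h m k = 0 → F.h m (k + 1) = 0)
    (hl : c.T m (l - 1) * F.h m (l - 1) ≤ c.T m l * F.h m l)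
    (hr : c.T m (l + 1) * F.h m (l + 1) ≤ c.T m l * F.h m l) (k : ℕ) :
    (c.T m k : ℝ) * F.h m k ≤ c.T m l * F.h m l := by
  refine le_of_logConcave (a := fun k => (c.T m k : ℝ) * F.h m k)
    (fun k => mul_nonneg (Nat.cast_nonneg _) (F.h_nonneg m k)) (fun k => ?_) (fun k h1 hk => ?_)
    (fun k hk h => ?_) hl hr k
  · calc _ = ((c.T m k : ℝ) * c.T m (k + 2)) * (F.h m k * F.h m (k + 2)) := by ring
      _ ≤ (c.T m (k + 1) : ℝ) ^ 2 * F.h m (k + 1) ^ 2 :=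
        mul_le_mul (c.T_logConcave m k) (hlc k) (mul_nonneg (F.h_nonneg _ _) (F.h_nonneg _ _))
          (sq_nonneg _)
      _ = _ := by ring
  · exact mul_pos (by exact_mod_cast c.T_pos h1 (hk.trans hlm)) (hpos k hk)
  · rcases mul_eq_zero.1 h with h | h
    · have hmk : m < k := by
        by_contra! hc
        exact (c.T_pos (hl1.trans hk) hc).ne' (by exact_mod_cast h)
      simp [c.T_eq_zero (show m < k + 1 by lia)]
    · simp [hzero k h]

/-- Binomial distributions with odds `θ`. -/
def pascal {θ : ℝ} (hθ : 0 < θ) : Forward .pascal where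
  h n k := θ ^ k / (1 + θ) ^ n
  q _ _ := θ / (1 + θ)
  μ n := n * (θ / (1 + θ))
  β := 1
  h_nonneg n k := by positivity
  h_zero := by simp
  μ_zero := by simp
  up n k := by rw [pow_succ, pow_succ]; field_simp
  stay n k := by simp only [Triangle.b]; rw [pow_succ]; field_simp; simp
  q_nonneg n k _ := by positivity
  q_le_one n k _ := by rw [div_le_one (by positivity)]; linarith
  β_nonneg := zero_le_one
  β_le_one := le_rfl
  mean n k := by push_cast; ring

/-- Sums of independent Bernoulli variables with parameters `θ / (θ + i)`. -/
def stirlingFirst {θ : ℝ} (hθ : 0 < θ) : Forward .stirlingFirst where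
  h n k := θ ^ k / ∏ i ∈ Finset.range n, (θ + i)
  q n _ := θ / (θ + n)
  μ n := ∑ i ∈ Finset.range n, θ / (θ + i)
  β := 1
  h_nonneg n k := by positivity
  h_zero := by simp
  μ_zero := by simp
  up n k := by
    have : 0 < ∏ i ∈ Finset.range n, (θ + i) := by positivity
    rw [pow_succ, Finset.prod_range_succ]; field_simp
  stay n k := by
    have : 0 < ∏ i ∈ Finset.range n, (θ + i) := by positivity
    simp only [Triangle.b, Nat.add_sub_cancel]
    rw [Finset.prod_range_succ]; field_simp; ring
  q_nonneg n k _ := by positivity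
  q_le_one n k _ := by
    rw [div_le_one (by positivity)]; linarith [Nat.cast_nonneg (α := ℝ) n]
  β_nonneg := zero_le_one
  β_le_one := le_rfl
  mean n k := by rw [Finset.sum_range_succ]; ring

/-- The number of occupied boxes when balls are thrown uniformly into `N` boxes. -/
def stirlingSecond {N : ℕ} (hN : 1 ≤ N) : Forward .stirlingSecond where
  h n k := N.descFactorial k / (N : ℝ) ^ n
  q _ k := 1 - k / N
  μ n := N * (1 - (1 - 1 / (N : ℝ)) ^ n)
  β := 1 - 1 / N
  h_nonneg n k := by positivity
  h_zero := by simp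
  μ_zero := by simp
  up n k := by
    have hN' : (N : ℝ) ≠ 0 := by positivity
    have : (N.descFactorial (k + 1) : ℝ) = (N - k) * N.descFactorial k := by
      rw [Nat.descFactorial_succ]
      rcases le_or_gt k N with h | h
      · push_cast [h]; ring
      · rw [Nat.descFactorial_eq_zero_iff_lt.2 h]; simp
    rw [this, pow_succ]; field_simp
  stay n k := by
    have hN' : (N : ℝ) ≠ 0 := by positivity
    simp only [Triangle.b]
    rw [pow_succ]; field_simp; ring
  -- For `k > N` the formula for `q` is negative, but `h` vanishes there.
  q_nonneg n k h := by
    have hk : k ≤ N := by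
      by_contra! hc
      exact h (by simp [Nat.descFactorial_eq_zero_iff_lt.2 hc])
    rw [sub_nonneg, div_le_one (by positivity)]
    exact_mod_cast hk
  q_le_one n k _ := by
    have : (0 : ℝ) ≤ k / N := by positivity
    linarith
  β_nonneg := by
    rw [sub_nonneg, div_le_one (by positivity)]
    exact_mod_cast hN
  β_le_one := by
    have : (0 : ℝ) ≤ 1 / N := by positivity
    linarith
  mean n k := by
    have hN' : (N : ℝ) ≠ 0 := by positivity
    rw [pow_succ]; field_simp; ring

theorem pascal_μ {θ : ℝ} (hθ : 0 < θ) (n : ℕ) : (pascal hθ).μ n = n * (θ / (1 + θ)) := rfl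

theorem stirlingSecond_h {N : ℕ} (hN : 1 ≤ N) (n k : ℕ) :
    (stirlingSecond hN).h n k = N.descFactorial k / (N : ℝ) ^ n := rfl

end Forward

/-- Exponential tilting makes `l` a mode. -/
theorem Forward.mode_of_pow {c : Triangle} (F : Forward c) {m l : ℕ} (hlm : l ≤ m) (hl : 2 ≤ l)
    {z : ℝ} (hz : 0 < z)
    (hF : ∀ k, F.h m k = ((c.T m (l - 1) : ℝ) / c.T m l) ^ k / z) :
    1 ≤ ((m : ℝ) + 1) * (c.T m l * F.h m l) := by
  obtain ⟨l, rfl⟩ : ∃ k, l = k + 1 := ⟨l - 1, by lia⟩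
  rw [Nat.add_sub_cancel] at hF
  have h0 : (0 : ℝ) < c.T m l := by exact_mod_cast c.T_pos (by lia) (by lia)
  have h1 : (0 : ℝ) < c.T m (l + 1) := by exact_mod_cast c.T_pos (by lia) (by lia)
  have h2 := c.T_logConcave m l
  set θ := (c.T m l : ℝ) / c.T m (l + 1) with hθ
  have hθ0 : 0 < θ := by positivity
  refine F.mode_bound (F.le_mode hlm (by lia) (fun k => ?_) (fun k _ => ?_) (fun k h => ?_) ?_ ?_)
  · rw [hF, hF, hF]; refine le_of_eq ?_; ring
  · rw [hF]; positivity
  · rw [hF] at h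
    exact absurd h (by positivity)
  · rw [Nat.add_sub_cancel, hF, hF, pow_succ]
    refine le_of_eq ?_
    rw [hθ]; field_simp
  -- The tilt `θ` equalizes the weights at the mode and just before it; log-concavity gives the
  -- comparison on the other side.
  · have : (c.T m (l + 1 + 1) : ℝ) * θ ≤ c.T m (l + 1) := by
      rw [hθ, mul_div_assoc', div_le_iff₀ h1, mul_comm, ← sq]; exact h2
    rw [hF, hF, pow_succ θ (l + 1)]
    calc _ = (c.T m (l + 1 + 1) : ℝ) * θ * (θ ^ (l + 1) / z) := by ring
      _ ≤ _ := mul_le_mul_of_nonneg_right this (by positivity)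

theorem Forward.mode_stirlingSecond {m l : ℕ} (hlm : l ≤ m) (hl : 2 ≤ l) :
    ∃ (N : ℕ) (hN : 1 ≤ N),
      1 ≤ ((m : ℝ) + 1) * (Triangle.stirlingSecond.T m l * (stirlingSecond hN).h m l) := by
  obtain ⟨l, rfl⟩ : ∃ k, l = k + 1 := ⟨l - 1, by lia⟩
  set c := Triangle.stirlingSecond
  have h0 : (0 : ℝ) < c.T m l := by exact_mod_cast c.T_pos (by lia) (by lia)
  have h1 : (0 : ℝ) < c.T m (l + 1) := by exact_mod_cast c.T_pos (by lia) (by lia)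
  have h2 := c.T_logConcave m l
  set θ := (c.T m l : ℝ) / c.T m (l + 1) with hθ
  have hθ0 : 0 < θ := by positivity
  -- The number of boxes is an integer, so exact equality of weights is not available. Rounding `θ`
  -- up settles the left neighbour, and `M < θ` with log-concavity the right one.
  obtain ⟨M, hM⟩ : ∃ M, ⌈θ⌉₊ = M + 1 := ⟨⌈θ⌉₊ - 1, by have := Nat.ceil_pos.2 hθ0; lia⟩
  have hM1 : θ ≤ (M : ℝ) + 1 := by
    have := Nat.le_ceil θ
    rw [hM] at this; exact_mod_cast this
  have hM2 : (M : ℝ) < θ := Nat.lt_ceil.1 (by lia)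
  have hN : 1 ≤ l + 1 + M := by lia
  refine ⟨l + 1 + M, hN, mode_bound _ (le_mode _ hlm (by lia) (fun k => ?_) (fun k hk => ?_)
    (fun k h => ?_) ?_ ?_)⟩
  · simp only [stirlingSecond_h]
    rw [div_mul_div_comm, div_pow, ← sq]
    gcongr
    norm_cast
    rw [Nat.descFactorial_succ _ (k + 1), Nat.descFactorial_succ _ k]
    set d := (l + 1 + M).descFactorial k
    calc _ = d ^ 2 * (l + 1 + M - k) * (l + 1 + M - (k + 1)) := by ring
      _ ≤ d ^ 2 * (l + 1 + M - k) * (l + 1 + M - k) := Nat.mul_le_mul_left _ (by lia)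
      _ = _ := by ring
  · rw [stirlingSecond_h]
    have : 0 < (l + 1 + M).descFactorial k := Nat.descFactorial_pos.2 (by lia)
    positivity
  · rw [stirlingSecond_h, div_eq_zero_iff] at h ⊢
    rcases h with h | h
    · left
      rw [Nat.cast_eq_zero, Nat.descFactorial_eq_zero_iff_lt] at h ⊢; lia
    · exact Or.inr h
  · rw [Nat.add_sub_cancel, stirlingSecond_h, stirlingSecond_h, mul_div_assoc', mul_div_assoc',
      Nat.descFactorial_succ, show l + 1 + M - l = M + 1 by lia]
    refine div_le_div_of_nonneg_right ?_ (by positivity)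
    push_cast
    rw [← mul_assoc]
    refine mul_le_mul_of_nonneg_right ?_ (Nat.cast_nonneg _)
    rw [hθ, div_le_iff₀ h1] at hM1
    linarith
  · rw [stirlingSecond_h, stirlingSecond_h, mul_div_assoc', mul_div_assoc',
      Nat.descFactorial_succ _ (l + 1), show l + 1 + M - (l + 1) = M by lia]
    refine div_le_div_of_nonneg_right ?_ (by positivity)
    push_cast
    rw [← mul_assoc]
    refine mul_le_mul_of_nonneg_right ?_ (Nat.cast_nonneg _)
    rw [hθ, lt_div_iff₀ h1] at hM2
    refine le_of_mul_le_mul_right ?_ h1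
    nlinarith [Nat.cast_nonneg (α := ℝ) (c.T m (l + 2))]

/-! ### Forward means and the curves -/

theorem abs_harmonic_sub_log_le {θ : ℝ} (hθ : 0 < θ) (n : ℕ) :
    |∑ i ∈ Finset.range n, θ / (θ + i) - θ * Real.log ((θ + n) / θ)| ≤ 1 := by
  -- Sum against integral of a decreasing function; keeping the extra term `θ/(θ+n)` makes the
  -- induction telescope.
  have h : 0 ≤ ∑ i ∈ Finset.range n, θ / (θ + i) - θ * Real.log ((θ + n) / θ) ∧
      ∑ i ∈ Finset.range n, θ / (θ + i) + θ / (θ + n) - 1 ≤ θ * Real.log ((θ + n) / θ) := by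
    induction n with
    | zero => simp [hθ.ne']
    | succ n ih =>
      have hn : 0 < θ + n := by positivity
      have hn' : 0 < θ + n + 1 := by positivity
      have hl : Real.log ((θ + (n + 1 : ℕ)) / θ) =
          Real.log ((θ + n) / θ) + Real.log ((θ + n + 1) / (θ + n)) := by
        rw [← Real.log_mul (by positivity) (by positivity)]
        congr 1; push_cast; field_simp; ring
      have h1 := Real.log_le_sub_one_of_pos (show 0 < (θ + n + 1) / (θ + n) by positivity)
      have h2 := Real.one_sub_inv_le_log_of_pos (show 0 < (θ + n + 1) / (θ + n) by positivity)
      rw [show (θ + n + 1) / (θ + n) - 1 = 1 / (θ + n) by field_simp; ring] at h1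
      rw [show 1 - ((θ + n + 1) / (θ + n))⁻¹ = 1 / (θ + n + 1) by field_simp; ring] at h2
      have h1 := mul_le_mul_of_nonneg_left h1 hθ.le
      have h2 := mul_le_mul_of_nonneg_left h2 hθ.le
      rw [mul_one_div] at h1 h2
      rw [hl, Finset.sum_range_succ, mul_add]
      push_cast
      rw [← add_assoc]
      constructor <;> linarith [ih.1, ih.2]
  have h3 : 0 < θ / (θ + n) := by positivity
  rw [abs_of_nonneg h.1]
  linarith [h.2]

theorem abs_geom_sub_exp_le {N : ℕ} (hN : 1 ≤ N) (n : ℕ) :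
    |(N : ℝ) * (1 - (1 - 1 / (N : ℝ)) ^ n) - N * (1 - Real.exp (-(n / N)))| ≤ 1 := by
  have hN0 : (0 : ℝ) < N := by positivity
  have hN1 : 1 / (N : ℝ) ≤ 1 := by rw [div_le_one hN0]; exact_mod_cast hN
  have hN2 : 0 < 1 / (N : ℝ) := by positivity
  set e := 1 / (N : ℝ) with he
  have hNe : N * e = 1 := by rw [he]; field_simp
  have hb := abs_le.1 (Real.abs_exp_sub_one_sub_id_le (x := -e) (by rwa [abs_neg, abs_of_pos hN2]))
  have hlow := Real.add_one_le_exp (-e)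
  have h : 0 ≤ Real.exp (-(n / N)) - (1 - e) ^ n ∧
      N * (Real.exp (-(n / N)) - (1 - e) ^ n) ≤ 1 := by
    induction n with
    | zero => simp
    | succ n ih =>
      have hexp : Real.exp (-(((n + 1 : ℕ) : ℝ) / N)) = Real.exp (-(n / N)) * Real.exp (-e) := by
        rw [← Real.exp_add, he]; congr 1; push_cast; ring
      have hle : Real.exp (-((n : ℝ) / N)) ≤ 1 :=
        Real.exp_le_one_iff.2 (neg_nonpos.2 (by positivity))
      have hpos := Real.exp_pos (-((n : ℝ) / N))
      rw [hexp, pow_succ, show Real.exp (-(n / N)) * Real.exp (-e) - (1 - e) ^ n * (1 - e) =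
        (Real.exp (-(n / N)) - (1 - e) ^ n) * (1 - e) +
          Real.exp (-(n / N)) * (Real.exp (-e) - (1 - e)) by ring]
      have h1 : 0 ≤ Real.exp (-e) - (1 - e) := by linarith
      have h2 : Real.exp (-e) - (1 - e) ≤ e ^ 2 := by nlinarith [hb.2]
      have h3 : Real.exp (-(n / N)) * (Real.exp (-e) - (1 - e)) ≤ 1 * e ^ 2 :=
        mul_le_mul hle h2 h1 zero_le_one
      constructor
      · exact add_nonneg (mul_nonneg ih.1 (by linarith)) (mul_nonneg hpos.le h1)
      -- The bound `1` reproduces itself: it contracts to `1 - e`, and the new error contributes at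
      -- most `N e² = e`.
      · have h4 := mul_le_mul_of_nonneg_right ih.2 (by linarith : 0 ≤ 1 - e)
        have h5 := mul_le_mul_of_nonneg_left h3 hN0.le
        have h6 : (N : ℝ) * (1 * e ^ 2) = e := by rw [one_mul, sq, ← mul_assoc, hNe, one_mul]
        rw [mul_add, ← mul_assoc]
        linarith
  rw [← mul_sub, sub_sub_sub_cancel_left, abs_of_nonneg (mul_nonneg hN0.le h.1)]
  exact h.2

theorem Forward.stirlingFirst_μ_approx {θ m : ℝ} (hθ : 0 < θ) (hm : 0 < m) {j : ℕ} :
    |(stirlingFirst hθ).μ j - m * curve (fun w => Real.log (1 + w)) (m / θ) (j / m)| ≤ 1 := by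
  have h : m * curve (fun w => Real.log (1 + w)) (m / θ) (j / m) =
      θ * Real.log ((θ + j) / θ) := by
    simp only [curve]
    rw [show 1 + m / θ * (j / m) = (θ + j) / θ by field_simp]
    field_simp
  rw [h]
  exact abs_harmonic_sub_log_le hθ j

theorem Forward.stirlingSecond_μ_approx {N : ℕ} {m : ℝ} (hN : 1 ≤ N) (hm : 0 < m) {j : ℕ} :
    |(stirlingSecond hN).μ j - m * curve (fun w => 1 - Real.exp (-w)) (m / N) (j / m)| ≤ 1 := by
  have h : m * curve (fun w => 1 - Real.exp (-w)) (m / N) (j / m) =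
      N * (1 - Real.exp (-(j / N))) := by
    simp only [curve]
    rw [show m / (N : ℝ) * (j / m) = j / N by field_simp]
    field_simp
  rw [h]
  exact abs_geom_sub_exp_le hN j

theorem lam_pos {m l : ℕ} (hl : 0 < l) (hlm : l < m) : 0 < lam m l :=
  div_pos (sub_pos.2 (by exact_mod_cast hlm)) (by exact_mod_cast hl)

theorem div_one_add_lam {m l : ℕ} (hl : 0 < l) (hm : 0 < m) : (m : ℝ) / (1 + lam m l) = l := by
  have : (0 : ℝ) < l := by exact_mod_cast hl
  have : (0 : ℝ) < m := by exact_mod_cast hm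
  rw [lam, show 1 + ((m : ℝ) - l) / l = m / l by field_simp; ring]
  field_simp

/-- A forward chain for which `l` is a mode at time `m`; its mean is close to the field line up to
the error at the end point. -/
theorem exists_forward (c : Triangle) {m l : ℕ} (hl : 2 ≤ l) (hlm : l < m) :
    ∃ F : Forward c, 1 ≤ ((m : ℝ) + 1) * (c.T m l * F.h m l) ∧
      ∀ j ≤ m, |F.μ j - m * c.gamma (lam m l) (j / m)| ≤ 2 + |(l : ℝ) - F.μ m| := by
  have hr : 0 < lam m l := lam_pos (by lia) hlm
  have hm0 : 0 < m := by lia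
  have hm : (0 : ℝ) < m := by exact_mod_cast hm0
  have hx := div_one_add_lam (show 0 < l by lia) hm0
  have hθ : (0 : ℝ) < (c.T m (l - 1) : ℝ) / c.T m l :=
    div_pos (by exact_mod_cast c.T_pos (by lia) (by lia))
      (by exact_mod_cast c.T_pos (by lia) hlm.le)
  cases c with
  | pascal =>
    refine ⟨.pascal hθ, Forward.mode_of_pow _ hlm.le hl (z := (1 + _) ^ m) (by positivity)
      fun k => rfl, fun j hj => ?_⟩
    rw [Forward.pascal_μ, Forward.pascal_μ]
    set p := (Triangle.pascal.T m (l - 1) : ℝ) / Triangle.pascal.T m l /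
      (1 + (Triangle.pascal.T m (l - 1) : ℝ) / Triangle.pascal.T m l)
    -- Mean and field line are both linear, so the error is the fraction `j/m` of the end-point
    -- error.
    have h1 : (j : ℝ) * p - m * Triangle.pascal.gamma (lam m l) (j / m) =
        (j / m) * -(l - m * p) := by
      rw [← hx]; simp only [Triangle.gamma]; field_simp; ring
    rw [h1, abs_mul, abs_neg, abs_of_nonneg (by positivity)]
    have h2 : (j : ℝ) / m ≤ 1 := by rw [div_le_one hm]; exact_mod_cast hj
    have := mul_le_of_le_one_left (abs_nonneg ((l : ℝ) - m * p)) h2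
    linarith
  | stirlingFirst =>
    refine ⟨.stirlingFirst hθ, Forward.mode_of_pow _ hlm.le hl (z := ∏ i ∈ Finset.range m, (_ + i))
      (by positivity) fun k => rfl, fun j hj => ?_⟩
    have := param_first.abs_sub_gamma_le (C := 1) hr (div_pos hm hθ) hm rfl hj (fun j _ => ?_) hx
      (f := (Forward.stirlingFirst hθ).μ)
    · simpa using this
    · exact Forward.stirlingFirst_μ_approx hθ hm
  | stirlingSecond =>
    obtain ⟨N, hN, hF⟩ := Forward.mode_stirlingSecond hlm.le hl
    refine ⟨.stirlingSecond hN, hF, fun j hj => ?_⟩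
    have hN0 : (0 : ℝ) < N := by positivity
    have := param_second.abs_sub_gamma_le (C := 1) hr (div_pos hm hN0) hm rfl hj (fun j _ => ?_) hx
      (f := (Forward.stirlingSecond hN).μ)
    · simpa using this
    · exact Forward.stirlingSecond_μ_approx hN hm

/-! ### Uniform bound and passage to the limit -/

theorem supDist_le {f g : ℝ → ℝ} {C : ℝ} (h : ∀ t, 0 ≤ t → t ≤ 1 → |f t - g t| ≤ C) :
    supDist f g ≤ ENNReal.ofReal C :=
  iSup₂_le fun t ht => ENNReal.ofReal_le_ofReal (h t ht.1 ht.2)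

/-- A quantitative form of the convergence of the sample paths. -/
theorem pathLaw_supDist_le (c : Triangle) {m l : ℕ} (hl : 2 ≤ l) (hlm : l < m) {s ε : ℝ}
    (hs0 : 0 ≤ s) (hs : s ≤ 1) (hε : 4 * s + 3 / m < ε) :
    c.pathLaw m l {W | ENNReal.ofReal ε ≤ supDist (rescaled W) (c.gamma (lam m l))} ≤
      ENNReal.ofReal (2 * ((m : ℝ) + 1) ^ 2 * Real.exp (-(m * s ^ 2))) := by
  have hm : (0 : ℝ) < m := by
    have : 0 < m := by lia
    exact_mod_cast this
  have hr : 0 < lam m l := lam_pos (by lia) hlm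
  -- In the second case the claimed bound is at least `1`, hence trivial.
  rcases lt_or_ge (2 * ((m : ℝ) + 1) * Real.exp (-(m * s ^ 2))) 1 with hsm | hsm
  swap
  · calc _ ≤ c.pathLaw m l univ := MeasureTheory.measure_mono (subset_univ _)
      _ = ENNReal.ofReal 1 := by
        rw [ENNReal.ofReal_one, Triangle.pathLaw]
        exact MeasureTheory.measure_univ
      _ ≤ _ := ENNReal.ofReal_le_ofReal (by nlinarith)
  obtain ⟨F, hF, hμ⟩ := exists_forward c hl hlm
  have hend := F.abs_sub_mean_le hlm.le hF hs0 hs hsm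
  have hsub : {W : Fin (m + 1) → ℕ × ℕ |
        ENNReal.ofReal ε ≤ supDist (rescaled W) (c.gamma (lam m l))} ⊆
      ⋃ j ∈ Finset.range (m + 1), {W | 2 * m * s ≤ |(levelX W j : ℝ) - F.μ j|} := by
    intro W hW
    by_contra hc
    simp only [mem_iUnion, mem_ofPred_eq, Finset.mem_range, not_exists, not_le] at hc
    refine absurd (mem_ofPred_eq ▸ hW : ENNReal.ofReal ε ≤ _) (not_le.2 ?_)
    -- The error is `2s` for the path around the mean, `2s` for the end point, `2/m` for the
    -- approximation of the mean, and `1/m` for the floor.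
    refine (supDist_le (C := 4 * s + 3 / m) fun t ht0 ht1 => ?_).trans_lt
      ((ENNReal.ofReal_lt_ofReal_iff_of_nonneg (by positivity)).2 hε)
    have hmt : 0 ≤ (m : ℝ) * t := by positivity
    set j := ⌊(m : ℝ) * t⌋₊ with hj
    have hj1 : (j : ℝ) ≤ m * t := Nat.floor_le hmt
    have hj2 : (m : ℝ) * t < j + 1 := Nat.lt_floor_add_one _
    have hjm : j ≤ m := by
      have : (j : ℝ) ≤ m := by nlinarith
      exact_mod_cast this
    have h1 : |rescaled W t - c.gamma (lam m l) (j / m)| ≤ 4 * s + 2 / m := by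
      have h2 := (abs_sub_le (levelX W j : ℝ) (F.μ j) (m * c.gamma (lam m l) (j / m))).trans
        (add_le_add (hc j (by lia)).le (hμ j hjm))
      rw [rescaled, ← hj, show (levelX W j : ℝ) / m - c.gamma (lam m l) (j / m) =
        ((levelX W j : ℝ) - m * c.gamma (lam m l) (j / m)) / m by field_simp, abs_div,
        abs_of_pos hm, div_le_iff₀ hm]
      rw [add_mul, div_mul_cancel₀ _ hm.ne']
      linarith
    have h2 : |c.gamma (lam m l) (j / m) - c.gamma (lam m l) t| ≤ 1 / m := by
      refine (c.abs_gamma_sub_le hr ht0 (by positivity)).trans ?_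
      rw [show (j : ℝ) / m - t = -((m * t - j) / m) by field_simp; ring, abs_neg, abs_div,
        abs_of_pos hm, abs_of_nonneg (by linarith)]
      gcongr
      linarith
    have h3 := abs_sub_le (rescaled W t) (c.gamma (lam m l) (j / m)) (c.gamma (lam m l) t)
    have h4 : (3 : ℝ) / m = 2 / m + 1 / m := by ring
    linarith
  calc _ ≤ _ := MeasureTheory.measure_mono hsub
    _ ≤ ∑ j ∈ Finset.range (m + 1), c.pathLaw m l {W | 2 * m * s ≤ |(levelX W j : ℝ) - F.μ j|} :=
      MeasureTheory.measure_biUnion_finset_le _ _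
    _ ≤ ∑ j ∈ Finset.range (m + 1),
        ENNReal.ofReal (2 * ((m : ℝ) + 1) * Real.exp (-(m * s ^ 2))) :=
      Finset.sum_le_sum fun j hj =>
        F.pathLaw_coord_le hF hs0 hs (Nat.lt_succ_iff.1 (Finset.mem_range.1 hj))
    _ = _ := by
      rw [Finset.sum_const, Finset.card_range, nsmul_eq_mul, ← ENNReal.ofReal_natCast,
        ← ENNReal.ofReal_mul (by positivity)]
      congr 1; push_cast; ring

theorem supDist_triangle_subset (c : Triangle) {m : ℕ} {r r' ε ε' : ℝ} (hr : 0 < r) (hr' : 0 < r')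
    (h0 : 0 ≤ ε') (h : |r' - r| ≤ ε') :
    {W : Fin (m + 1) → ℕ × ℕ | ENNReal.ofReal ε ≤ supDist (rescaled W) (c.gamma r)} ⊆
      {W | ENNReal.ofReal (ε - ε') ≤ supDist (rescaled W) (c.gamma r')} := by
  intro W hW
  have hW : ENNReal.ofReal ε ≤ supDist (rescaled W) (c.gamma r) := hW
  show ENNReal.ofReal (ε - ε') ≤ supDist (rescaled W) (c.gamma r')
  rw [ENNReal.ofReal_sub _ h0, tsub_le_iff_right]
  refine hW.trans (iSup₂_le fun t ht => ?_)
  calc _ ≤ ENNReal.ofReal (|rescaled W t - c.gamma r' t| + ε') := by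
        refine ENNReal.ofReal_le_ofReal ((abs_sub_le _ (c.gamma r' t) _).trans ?_)
        exact add_le_add le_rfl ((c.abs_gamma_sub_gamma_le hr' hr ht.1 ht.2).trans h)
    _ = ENNReal.ofReal |rescaled W t - c.gamma r' t| + ENNReal.ofReal ε' :=
        ENNReal.ofReal_add (abs_nonneg _) h0
    _ ≤ _ := add_le_add
        (le_iSup₂ (f := fun t _ => ENNReal.ofReal |rescaled W t - c.gamma r' t|) t ht) le_rfl

theorem tendsto_tail {d : ℝ} (hd : 0 < d) :
    Tendsto (fun x : ℝ => 2 * (x + 1) ^ 2 * Real.exp (-(x ^ d))) atTop (𝓝 0) := by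
  -- In the variable `x^d` the factor `x²` has exponent `2/d`; the `8` comes from `(x+1)² ≤ 4x²` for
  -- `x ≥ 1`.
  have h1 := ((tendsto_rpow_mul_exp_neg_mul_atTop_nhds_zero (2 / d) 1 one_pos).comp
    (tendsto_rpow_atTop hd)).const_mul 8
  rw [mul_zero] at h1
  refine squeeze_zero' (Eventually.of_forall fun x => by positivity) ?_ h1
  filter_upwards [eventually_ge_atTop 1] with x hx
  have hx0 : 0 < x := by linarith
  simp only [Function.comp_apply]
  rw [← Real.rpow_mul hx0.le, mul_div_cancel₀ _ hd.ne', Real.rpow_two, neg_one_mul, ← mul_assoc]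
  refine mul_le_mul_of_nonneg_right ?_ (Real.exp_pos _).le
  nlinarith

theorem eventually_rate {e e' κ : ℝ} (h : e < e') (h1 : e' < 1) (hκ : 0 < κ) :
    ∀ᶠ x : ℝ in atTop, 4 * x ^ (-e') + 3 / x < κ * x ^ (-e) := by
  have l1 := (tendsto_rpow_neg_atTop (sub_pos.2 h)).const_mul 4
  have l2 := (tendsto_rpow_neg_atTop (show 0 < 1 - e by linarith)).const_mul 3
  have l := l1.add l2
  rw [mul_zero, mul_zero, add_zero] at l
  filter_upwards [l.eventually (gt_mem_nhds hκ), eventually_gt_atTop 0] with x hx hx0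
  have hp : 0 < x ^ (-e) := Real.rpow_pos_of_pos hx0 _
  have := mul_lt_mul_of_pos_right hx hp
  rw [add_mul, mul_assoc, mul_assoc, ← Real.rpow_add hx0, ← Real.rpow_add hx0,
    show -(e' - e) + -e = -e' by ring, show -(1 - e) + -e = -1 by ring, Real.rpow_neg_one] at this
  rwa [div_eq_mul_inv]

section Limits

variable (c : Triangle) {r : ℝ} (hr : 0 < r) {m l : ℕ → ℕ}
  (hm : Tendsto m atTop atTop) (hl : Tendsto l atTop atTop)
  (hlam : Tendsto (fun i => lam (m i) (l i)) atTop (𝓝 r))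
include hr hl hlam

theorem eventually_two_le_and_lt : ∀ᶠ i in atTop, 2 ≤ l i ∧ l i < m i := by
  filter_upwards [hl.eventually_ge_atTop 2, hlam.eventually (lt_mem_nhds hr)] with i h2 hp
  refine ⟨h2, ?_⟩
  have hl0 : (0 : ℝ) < l i := by
    have : 0 < l i := by lia
    exact_mod_cast this
  rw [lam, div_pos_iff_of_pos_right hl0, sub_pos] at hp
  exact_mod_cast hp

include hm

theorem tendsto_pathLaw_rate {e κ : ℝ} (he : 0 < e) (he' : e < 1 / 2) (hκ : 0 < κ) :
    Tendsto (fun i => c.pathLaw (m i) (l i) {W | ENNReal.ofReal (κ * (m i : ℝ) ^ (-e)) ≤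
      supDist (rescaled W) (c.gamma (lam (m i) (l i)))}) atTop (𝓝 0) := by
  -- With `s = m^(-e')`, `e < e'` makes `4s + 3/m` negligible against `m^(-e)`, and `e' < 1/2` makes
  -- `m s²` tend to infinity.
  obtain ⟨e', h1, h2⟩ := exists_between he'
  have hmR : Tendsto (fun i => (m i : ℝ)) atTop atTop := tendsto_natCast_atTop_atTop.comp hm
  have hlim := ENNReal.tendsto_ofReal
    ((tendsto_tail (show 0 < 1 - 2 * e' by linarith)).comp hmR)
  rw [ENNReal.ofReal_zero] at hlim
  refine tendsto_of_tendsto_of_tendsto_of_le_of_le' tendsto_const_nhds hlim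
    (Eventually.of_forall fun _ => zero_le) ?_
  filter_upwards [eventually_two_le_and_lt hr hl hlam,
    hmR.eventually (eventually_rate h1 (by linarith) hκ), hmR.eventually_ge_atTop 1]
    with i hi hrate hone
  have hpos : (0 : ℝ) < m i := by linarith
  refine (pathLaw_supDist_le c hi.1 hi.2 (Real.rpow_nonneg hpos.le (-e'))
    (Real.rpow_le_one_of_one_le_of_nonpos hone (by linarith)) hrate).trans (le_of_eq ?_)
  have : (m i : ℝ) * ((m i : ℝ) ^ (-e')) ^ 2 = (m i : ℝ) ^ (1 - 2 * e') := by
    rw [← Real.rpow_natCast, ← Real.rpow_mul hpos.le]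
    nth_rewrite 1 [← Real.rpow_one (m i : ℝ)]
    rw [← Real.rpow_add hpos]
    congr 1; push_cast; ring
  simp only [Function.comp_apply, this]

/-- Transfer to the limit curve: the error `|lam - r|` is absorbed in half the width. -/
theorem tendsto_pathLaw_limit {e : ℝ} (he : 0 < e) (he' : e < 1 / 2) {ε : ℕ → ℝ}
    (h1 : ∀ᶠ i in atTop, |lam (m i) (l i) - r| ≤ ε i / 2)
    (h2 : ∀ᶠ i in atTop, 1 / 2 * (m i : ℝ) ^ (-e) ≤ ε i / 2) :
    Tendsto (fun i => c.pathLaw (m i) (l i) {W | ENNReal.ofReal (ε i) ≤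
      supDist (rescaled W) (c.gamma r)}) atTop (𝓝 0) := by
  refine tendsto_of_tendsto_of_tendsto_of_le_of_le' tendsto_const_nhds
    (tendsto_pathLaw_rate c hr hm hl hlam he he' (κ := 1 / 2) (by norm_num))
    (Eventually.of_forall fun _ => zero_le) ?_
  filter_upwards [eventually_two_le_and_lt hr hl hlam, h1, h2] with i hi h1 h2
  refine MeasureTheory.measure_mono ((supDist_triangle_subset c hr (lam_pos (by lia) hi.2)
    ((abs_nonneg _).trans h1) h1).trans fun W hW => ?_)
  refine le_trans (ENNReal.ofReal_le_ofReal ?_) hW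
  linarith

end Limits

end PascalChain

end

theorem mainTheorem1 :
    -- `ζ₂(r)` and `ζ₃(r)` are well defined
    (∀ r : ℝ, 0 < r → (∃! z, PascalChain.IsZeta2 r z) ∧ (∃! z, PascalChain.IsZeta3 r z)) ∧
    -- the explicit curves are the field lines
    (∀ (c : PascalChain.Triangle) (r B : ℝ), 0 < r → 1 ≤ B →
      c.IsFieldLine r B (c.gamma r) ∧
      ∀ y : ℝ → ℝ, c.IsFieldLine r B y → EqOn y (c.gamma r) (Icc 0 B)) ∧
    -- convergence of the sample paths
    (∀ (c : PascalChain.Triangle) (r : ℝ), 0 < r →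
      ∀ m l : ℕ → ℕ, Tendsto m atTop atTop → Tendsto l atTop atTop →
      Tendsto (fun i => PascalChain.lam (m i) (l i)) atTop (𝓝 r) →
      -- rate `m^{-η}` around the field line through the starting point
      (∀ η : ℝ, 0 < η → η < 1 / 2 →
        Tendsto (fun i => c.pathLaw (m i) (l i)
          {W | ENNReal.ofReal ((m i : ℝ) ^ (-η)) ≤
            PascalChain.supDist (PascalChain.rescaled W)
              (c.gamma (PascalChain.lam (m i) (l i)))}) atTop (𝓝 0)) ∧
      -- the same rate around the limit field line, if `λ(m,ℓ) - r = o(m^{-η})`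
      (∀ η : ℝ, 0 < η → η < 1 / 2 →
        Tendsto (fun i => (m i : ℝ) ^ η * (PascalChain.lam (m i) (l i) - r)) atTop (𝓝 0) →
        Tendsto (fun i => c.pathLaw (m i) (l i)
          {W | ENNReal.ofReal ((m i : ℝ) ^ (-η)) ≤
            PascalChain.supDist (PascalChain.rescaled W) (c.gamma r)}) atTop (𝓝 0)) ∧
      -- uniform convergence in probability to the limit field line, in all cases
      (∀ δ : ℝ, 0 < δ →
        Tendsto (fun i => c.pathLaw (m i) (l i)
          {W | ENNReal.ofReal δ ≤
            PascalChain.supDist (PascalChain.rescaled W) (c.gamma r)}) atTop (𝓝 0))) := by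
  refine ⟨fun r hr => ⟨PascalChain.existsUnique_isZeta2 hr, PascalChain.existsUnique_isZeta3 hr⟩,
    fun c r B hr hB => ⟨c.isFieldLine_gamma hr, fun y hy => c.eqOn_gamma hr hB hy⟩,
    fun c r hr m l hm hl hlam => ⟨fun η h0 h1 => ?_, fun η h0 h1 hη => ?_, fun δ hδ => ?_⟩⟩
  · simpa only [one_mul] using
      PascalChain.tendsto_pathLaw_rate c hr hm hl hlam h0 h1 (κ := 1) one_pos
  · refine PascalChain.tendsto_pathLaw_limit c hr hm hl hlam h0 h1 ?_
      (Eventually.of_forall fun i => by linarith)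
    have hhalf := hη.abs.eventually (gt_mem_nhds (show |(0 : ℝ)| < 1 / 2 by norm_num))
    filter_upwards [hhalf, hm.eventually_gt_atTop 0] with i hi hpos
    have hpos : (0 : ℝ) < m i := by exact_mod_cast hpos
    have hp : 0 < (m i : ℝ) ^ η := Real.rpow_pos_of_pos hpos η
    rw [abs_mul, abs_of_pos hp] at hi
    rw [Real.rpow_neg hpos.le, inv_eq_one_div, div_right_comm, le_div_iff₀ hp, mul_comm]
    exact hi.le
  · have hmR : Tendsto (fun i => (m i : ℝ)) atTop atTop := tendsto_natCast_atTop_atTop.comp hm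
    -- Any exponent in `(0, 1/2)` would do, as `m^(-e)` eventually falls below `δ`.
    refine PascalChain.tendsto_pathLaw_limit c hr hm hl hlam (e := 1 / 4) (by norm_num)
      (by norm_num) ?_ ?_
    · have := (hlam.sub_const r).abs.eventually
        (gt_mem_nhds (show |r - r| < δ / 2 by rw [sub_self, abs_zero]; linarith))
      filter_upwards [this] with i hi using hi.le
    · have := (tendsto_rpow_neg_atTop (show (0 : ℝ) < 1 / 4 by norm_num)).comp hmR
      filter_upwards [this.eventually (gt_mem_nhds hδ)] with i hi
      simp only [Function.comp_apply] at hi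
      linarith
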